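/- Let $N\ge 1$, let $\mathbf T$ be the complex unit circle, and let $L^\infty$ be the algebra of $N\times N$ matrix functions on $\mathbf T$ with entries in $L^\infty(\mathbf T)$. For $a\in L^\infty$ let $a_k=\frac1{2\pi}\int_0^{2\pi}a(e^{i\theta})e^{-ik\theta}\,d\theta$ ($k\in\mathbf Z$) be its Fourier coefficients, and let $L(a)=(a_{j-k})_{j,k\in\mathbf Z}$ be the block Laurent operator on $\ell^2(\mathbf Z,\mathbf C^N)$. Put $$K_1^1=\Big\{a\in L^\infty:\ \sum_{n\in\mathbf Z}(|n|+1)\|a_n\|<\infty\Big\},\qquad H^\infty_\pm=\{a\in L^\infty:\ a_{\mp n}=0\text{ for } n>0\},$$ where $\|\cdot\|$ is any matrix norm. Write $a\in\Phi_r(K_1^1)$ (resp. $a\in\Phi_l(K_1^1)$) if $a=u_-u_+$ (resp. $a=v_+v_-$) with $u_-,v_-,u_-^{-1},v_-^{-1}\in K_1^1\cap H^\infty_-$ and $u_+,v_+,u_+^{-1},v_+^{-1}\in K_1^1\cap H^\infty_+$. On $\ell^2(\mathbf Z,\mathbf C^N)$ let $P$, $Q$ and $Q_n$ ($n\in\mathbf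 Z$) be the coordinate projections onto the indices $k\ge 0$, $k<0$ and $k\ge n$, respectively. **Theorem 1.3 (Baik-Deift-Rains).** Let $a\in\Phi_r(K_1^1)\cap\Phi_l(K_1^1)$, $n\in\mathbf Z$ and $s\in\mathbf C$. Then each of the operators $$I+sP-sL(a)Q_nL(a^{-1}),\qquad I-s^2Q_nL(a^{-1})QL(a)Q_n,\qquad I-s^2(I-Q_n)L(a^{-1})PL(a)(I-Q_n)$$ is the identity plus a trace class operator, and their Fredholm determinants satisfy $$\det\big(I+sP-sL(a)Q_nL(a^{-1})\big)=(1+s)^{nN}\det\big(I-s^2Q_nL(a^{-1})QL(a)Q_n\big)\qquad(s\ne-1),$$ $$\det\big(I+sP-sL(a)Q_nL(a^{-1})\big)=(1-s)^{-nN}\det\big(I-s^2(I-Q_n)L(a^{-1})PL(a)(I-Q_n)\big)\qquad(s\ne1).$$ -/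

import Mathlib

open MeasureTheory Filter Topology
open scoped ENNReal

noncomputable section

namespace BlockToeplitz

/-! ### Trace class operators and determinants on a complex Hilbert space -/

section Determinant

universe u

variable {H : Type u} [NormedAddCommGroup H] [InnerProductSpace ℂ H]

/-- `K` is of trace class (a nuclear operator): it is a sum of rank one operators
`v ↦ ⟪x i, v⟫ y i` whose norms `‖x i‖ ‖y i‖` are summable. -/
def IsTraceClass (K : H →L[ℂ] H) : Prop :=
  ∃ x y : ℕ → H, Summable (fun i => ‖x i‖ * ‖y i‖) ∧
    ∀ v : H, HasSum (fun i => inner ℂ (x i) v • y i) (K v)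

/-- The determinant of the section `(⟪b i, T (b j)⟫)_{i, j ∈ S}` of the matrix of `T` in the
orthonormal basis `b`, for a finite set `S` of indices. -/
def sectionDet {ι : Type u} (b : HilbertBasis ι ℂ H) (T : H →L[ℂ] H) (S : Finset ι) : ℂ :=
  letI : DecidableEq ι := Classical.decEq ι
  Matrix.det (Matrix.of fun i j : S => inner ℂ (b i) (T (b j)))

/-- `T` is of the form `I + K` with `K` of trace class, and `d` is its Fredholm determinant
`det (I + K)`: the limit, in every orthonormal basis, of the determinants of the finite
sections of the matrix of `I + K`. -/
def HasFredholmDet (T : H →L[ℂ] H) (d : ℂ) : Prop :=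
  IsTraceClass (T - 1) ∧
    ∀ (ι : Type u) (b : HilbertBasis ι ℂ H), Tendsto (sectionDet b T) atTop (𝓝 d)

/-- A Fredholm determinant is unique. -/
theorem HasFredholmDet.unique [CompleteSpace H] {T : H →L[ℂ] H} {d e : ℂ}
    (hd : HasFredholmDet T d) (he : HasFredholmDet T e) : d = e := by
  obtain ⟨w, b, -⟩ := exists_hilbertBasis ℂ H
  exact tendsto_nhds_unique (hd.2 w b) (he.2 w b)

end Determinant

/-! ### Matrix functions on the unit circle

The unit circle is parametrized by `θ ↦ exp (i θ)`, `θ ∈ ℝ / 2πℤ`, and carries the normalized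
Lebesgue measure. Matrix functions are identified when they agree almost everywhere: all
notions below are invariant under such changes. -/

instance factTwoPiPos : Fact (0 < 2 * Real.pi) := ⟨Real.two_pi_pos⟩

/-- The unit circle, as `ℝ / 2πℤ`. -/
abbrev UCircle : Type := AddCircle (2 * Real.pi)

/-- Normalized Lebesgue measure on the unit circle. -/
abbrev haarT : Measure UCircle := AddCircle.haarAddCircle

/-- `N × N` matrix functions on the unit circle. -/
abbrev MatFun (N : ℕ) : Type := UCircle → Matrix (Fin N) (Fin N) ℂ

variable {N : ℕ}

/-- The algebra `L^∞` of matrix functions with essentially bounded measurable entries. -/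
def LInf (N : ℕ) : Set (MatFun N) :=
  {a | ∀ i j, MemLp (fun t => a t i j) ∞ haarT}

/-- The `n`-th Fourier coefficient `a_n` of a matrix function, taken entrywise. -/
def coeff (a : MatFun N) (n : ℤ) : Matrix (Fin N) (Fin N) ℂ :=
  Matrix.of fun i j => fourierCoeff (fun t => a t i j) n

/-- The Fourier coefficient is `(1 / 2π) ∫_0^{2π} a(e^{iθ}) e^{-inθ} dθ`. -/
theorem coeff_apply (a : MatFun N) (n : ℤ) (i j : Fin N) :
    coeff a n i j = (1 / (2 * Real.pi)) *
      ∫ θ in (0 : ℝ)..2 * Real.pi, Complex.exp (-(n * θ * Complex.I)) * a (θ : UCircle) i j := by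
  have h := fourierCoeff_eq_intervalIntegral (fun t : UCircle => a t i j) n 0
  rw [coeff, Matrix.of_apply, h, zero_add, Complex.real_smul]
  push_cast
  congr 1
  apply intervalIntegral.integral_congr
  intro θ _
  have hpi : (Real.pi : ℂ) ≠ 0 := by exact_mod_cast Real.pi_ne_zero
  simp only [fourier_coe_apply, smul_eq_mul]
  congr 2
  push_cast
  field_simp

/-- The weighted Wiener algebra `K_1^1`: `∑ (|n| + 1) ‖a_n‖ < ∞`, with the matrix norm
`‖m‖ = ∑ |m i j|` (all matrix norms being equivalent). -/
def K11 (N : ℕ) : Set (MatFun N) :=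
  {a | a ∈ LInf N ∧ Summable fun n : ℤ => (|(n : ℝ)| + 1) * ∑ i, ∑ j, ‖coeff a n i j‖}

/-- The Hardy space `H^∞_+`: the Fourier coefficients of negative index vanish. -/
def HardyPlus (N : ℕ) : Set (MatFun N) :=
  {a | a ∈ LInf N ∧ ∀ n : ℤ, 0 < n → coeff a (-n) = 0}

/-- The Hardy space `H^∞_-`: the Fourier coefficients of positive index vanish. -/
def HardyMinus (N : ℕ) : Set (MatFun N) :=
  {a | a ∈ LInf N ∧ ∀ n : ℤ, 0 < n → coeff a n = 0}

/-- The pointwise inverse `a^{-1}` of a matrix function; it is used only for matrix functions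
that are invertible almost everywhere. -/
def pinv (a : MatFun N) : MatFun N := fun t => (a t)⁻¹

/-- `u` is invertible (almost everywhere), and both `u` and `u^{-1}` lie in `E`. -/
def InvertibleIn (E : Set (MatFun N)) (u : MatFun N) : Prop :=
  u ∈ E ∧ (∀ᵐ t ∂haarT, IsUnit (u t)) ∧ pinv u ∈ E

/-- `Φ_r(E)`: matrix functions with a right canonical Wiener-Hopf factorization
`a = u_- u_+` in `E`. -/
def PhiR (E : Set (MatFun N)) : Set (MatFun N) :=
  {a | a ∈ LInf N ∧ ∃ uMinus uPlus : MatFun N, (∀ᵐ t ∂haarT, a t = uMinus t * uPlus t) ∧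
    InvertibleIn (E ∩ HardyMinus N) uMinus ∧ InvertibleIn (E ∩ HardyPlus N) uPlus}

/-- `Φ_l(E)`: matrix functions with a left canonical Wiener-Hopf factorization
`a = v_+ v_-` in `E`. -/
def PhiL (E : Set (MatFun N)) : Set (MatFun N) :=
  {a | a ∈ LInf N ∧ ∃ vPlus vMinus : MatFun N, (∀ᵐ t ∂haarT, a t = vPlus t * vMinus t) ∧
    InvertibleIn (E ∩ HardyPlus N) vPlus ∧ InvertibleIn (E ∩ HardyMinus N) vMinus}

/-! ### Operators on `ℓ²(ℤ, ℂ^N)` -/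

/-- The Hilbert space `ℓ²(ℤ, ℂ^N)`. -/
abbrev L2Z (N : ℕ) : Type := lp (fun _ : ℤ => EuclideanSpace ℂ (Fin N)) 2

/-- Multiplication by `f ∈ L^∞` on the scalar space `L²` (and `0` for `f ∉ L^∞`). -/
def mulOp (f : UCircle → ℂ) : Lp ℂ 2 haarT →L[ℂ] Lp ℂ 2 haarT :=
  open Classical in
  if hf : MemLp f ∞ haarT then
    (ContinuousLinearMap.mul ℂ ℂ).holderL haarT ∞ 2 2 hf.toLp
  else 0

/-- The scalar Laurent operator on `ℓ²(ℤ)`: multiplication by `f`, read in Fourier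
coefficients. -/
def scalarLaurent (f : UCircle → ℂ) :
    lp (fun _ : ℤ => ℂ) 2 →L[ℂ] lp (fun _ : ℤ => ℂ) 2 :=
  ((fourierBasis (T := 2 * Real.pi)).repr.toContinuousLinearEquiv.toContinuousLinearMap ∘L
    mulOp f) ∘L
      (fourierBasis (T := 2 * Real.pi)).repr.symm.toContinuousLinearEquiv.toContinuousLinearMap

/-- The map `ℓ²(ℤ, ℂ^N) → ℓ²(ℤ)` that takes the `i`-th entry of every term. -/
def entry (i : Fin N) : L2Z N →L[ℂ] lp (fun _ : ℤ => ℂ) 2 :=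
  lp.mapCLM 2 (fun _ => (EuclideanSpace.proj i : EuclideanSpace ℂ (Fin N) →L[ℂ] ℂ))
    (norm_nonneg (EuclideanSpace.proj i : EuclideanSpace ℂ (Fin N) →L[ℂ] ℂ)) fun _ => le_rfl

/-- The map `z ↦ z e_i` from `ℂ` to `ℂ^N`. -/
def unitVec (i : Fin N) : ℂ →L[ℂ] EuclideanSpace ℂ (Fin N) :=
  ContinuousLinearMap.toSpanSingleton ℂ (EuclideanSpace.single i (1 : ℂ))

/-- The map `ℓ²(ℤ) → ℓ²(ℤ, ℂ^N)` that puts a sequence in the `i`-th entry. -/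
def embed (i : Fin N) : lp (fun _ : ℤ => ℂ) 2 →L[ℂ] L2Z N :=
  lp.mapCLM 2 (fun _ => unitVec i) (norm_nonneg (unitVec i)) fun _ => le_rfl

/-- The block Laurent operator `L(a)` on `ℓ²(ℤ, ℂ^N)`, for `a ∈ L^∞`. -/
def laurent (a : MatFun N) : L2Z N →L[ℂ] L2Z N :=
  ∑ i, ∑ j, (embed i ∘L scalarLaurent (fun t => a t i j)) ∘L entry j

/-- The projection of `ℓ²(ℤ, ℂ^N)` that keeps the terms with index in `S` and replaces the
others by `0`. -/
def coordProj (N : ℕ) (S : Set ℤ) : L2Z N →L[ℂ] L2Z N :=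
  open Classical in
  lp.mapCLM 2 (fun k => if k ∈ S then ContinuousLinearMap.id ℂ (EuclideanSpace ℂ (Fin N)) else 0)
    zero_le_one fun k => by
      split_ifs
      · exact ContinuousLinearMap.norm_id_le
      · simp

/-- The projection `P` onto the coordinates `k ≥ 0`. -/
def projP (N : ℕ) : L2Z N →L[ℂ] L2Z N := coordProj N {k | 0 ≤ k}

/-- The projection `Q` onto the coordinates `k < 0`. -/
def projQ (N : ℕ) : L2Z N →L[ℂ] L2Z N := coordProj N {k | k < 0}

/-- The projection `Q_n` onto the coordinates `k ≥ n`. -/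
def projQn (N : ℕ) (n : ℤ) : L2Z N →L[ℂ] L2Z N := coordProj N {k | n ≤ k}

open Classical in
theorem coordProj_apply (S : Set ℤ) (x : L2Z N) (k : ℤ) :
    coordProj N S x k = if k ∈ S then x k else 0 := by
  rw [coordProj, lp.mapCLM_apply_coe]
  split_ifs <;> simp

theorem scalarLaurent_single {f : UCircle → ℂ} (hf : MemLp f ∞ haarT) (j k : ℤ) :
    scalarLaurent f (lp.single 2 k (1 : ℂ)) j = fourierCoeff f (j - k) := by
  have h1 : (fourierBasis (T := 2 * Real.pi)).repr.symm (lp.single 2 k (1 : ℂ)) =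
      fourierLp (T := 2 * Real.pi) 2 k := by
    rw [HilbertBasis.repr_symm_single, coe_fourierBasis]
  have h2 : scalarLaurent f (lp.single 2 k (1 : ℂ)) =
      (fourierBasis (T := 2 * Real.pi)).repr (mulOp f (fourierLp (T := 2 * Real.pi) 2 k)) := by
    rw [← h1]; rfl
  rw [h2, fourierBasis_repr, mulOp, dif_pos hf]
  unfold fourierCoeff
  apply integral_congr_ae
  have h3 := ContinuousLinearMap.coeFn_holder (r := 2) (ContinuousLinearMap.mul ℂ ℂ)
    hf.toLp (fourierLp (T := 2 * Real.pi) 2 k)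
  filter_upwards [h3, hf.coeFn_toLp, coeFn_fourierLp (T := 2 * Real.pi) 2 k] with t h3 h4 h5
  rw [ContinuousLinearMap.holderL_apply_apply, h3, h4, h5, ContinuousLinearMap.mul_apply',
    show -(j - k) = -j + k by ring, fourier_add, smul_eq_mul, smul_eq_mul]
  ring

/-- The matrix of `L(a)` in the standard basis of `ℓ²(ℤ, ℂ^N)` is `(a_{j-k})_{j,k ∈ ℤ}`. -/
theorem laurent_single {a : MatFun N} (ha : a ∈ LInf N) (j k : ℤ) (α β : Fin N) :
    laurent a (lp.single 2 k (EuclideanSpace.single β (1 : ℂ))) j α = coeff a (j - k) α β := by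
  have h1 : ∀ j', entry j' (lp.single 2 k (EuclideanSpace.single β (1 : ℂ))) =
      if j' = β then lp.single 2 k (1 : ℂ) else 0 := by
    intro j'
    ext m
    rw [entry, lp.mapCLM_apply_coe, lp.single_apply]
    by_cases hm : m = k
    · subst hm
      by_cases hj : j' = β <;> simp [hj]
    · by_cases hj : j' = β <;> simp [hm, hj]
  have h2 : ∀ (i : Fin N) (x : lp (fun _ : ℤ => ℂ) 2), (embed i x) j α =
      if α = i then x j else 0 := by
    intro i x
    rw [embed, lp.mapCLM_apply_coe, unitVec]
    simp
  simp only [laurent, _root_.sum_apply, ContinuousLinearMap.comp_apply, h1]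
  rw [lp.coeFn_sum, Finset.sum_apply, WithLp.ofLp_sum, Finset.sum_apply]
  simp only [lp.coeFn_sum, Finset.sum_apply, WithLp.ofLp_sum, h2]
  rw [Finset.sum_eq_single α (by intro b _ hb; simp [hb.symm]) (by simp),
    Finset.sum_eq_single β (by intro b _ hb; simp [hb]) (by simp)]
  simp [scalarLaurent_single (ha α β), coeff]

end BlockToeplitz

end

open BlockToeplitz

/-! Write `A = L(a)` and `R = Q_n`. The factorization `a = u_- u_+` gives `A = U₁ U₂`, where `U₁`,
`U₁⁻¹` preserve the kernel of `P` and `U₂`, `U₂⁻¹` preserve the range of `R`. Conjugation by `U₁`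
turns `I + sP - sARA⁻¹` into `I + sP - sR + sX - sY`, with `X = U₁⁻¹PU₁ - P` and `Y = U₂RU₂⁻¹ - R`.
Cyclicity of the determinant turns `I - s²RA⁻¹QAR` into `I - s²(I - P - X)(R + Y)`. Here `X = XP`,
`PX = 0`, `Y = RY`, `YR = 0`, so both operators split into factors of determinant one, a part of
determinant `det (I + s²XY)`, and `I` plus a multiple of the projection `±(P - R)` of rank `|n|N`,
which produces the powers (`exists_hasFredholmDet_of_factorization`). The second identity is the
first one for `a = v_+ v_-` with `I - P`, `I - R`, `-s` in place of `P`, `R`, `s`: the left-hand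
operator does not change.

`X` and `Y` are trace class because a Hankel block contains at most `|m|` entries `a_m`, which is
the weight in `K11`.

Determinants are limits of finite sections in all bases, so their theory is built from nuclear
representations `K = ∑ ⟪x i, ·⟫ y i`. The value is `gramDet x y`, absolutely convergent by
Hadamard's inequality. A finite section is the same series with projected `y i`, and dominated
convergence gives the limit (`tendsto_sectionDet`), then cyclicity and multiplicativity. -/

noncomputable section

namespace BlockToeplitz

/-! ### Principal minors and Hadamard's inequality -/

section LinearAlgebra

/-- `det (1 + M)` is the sum of all principal minors of `M`. -/
theorem det_one_add_eq_sum_minors {n R : Type*} [Fintype n] [DecidableEq n] [CommRing R]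
    (M : Matrix n n R) :
    (1 + M).det = ∑ s : Finset n, (M.submatrix (Subtype.val : s → n) Subtype.val).det := by
  rw [add_comm]
  refine ((Matrix.detRowAlternating (n := n) (R := R)).map_add_univ M.row
    (1 : Matrix n n R).row).trans (Finset.sum_congr rfl fun s _ => ?_)
  exact Matrix.det_piecewise_one_eq_submatrix_det M s

/-- Hadamard's inequality. -/
theorem norm_det_orthonormalBasis_le {n : ℕ} {E : Type*} [NormedAddCommGroup E]
    [InnerProductSpace ℂ E] (b : OrthonormalBasis (Fin n) ℂ E) (f : Fin n → E) :
    ‖b.toBasis.det f‖ ≤ ∏ i, ‖f i‖ := by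
  have : FiniteDimensional ℂ E := b.toBasis.finiteDimensional_of_finite
  have h : Module.finrank ℂ E = Fintype.card (Fin n) := Module.finrank_eq_card_basis b.toBasis
  set g := InnerProductSpace.gramSchmidtOrthonormalBasis h f
  -- Passing to the Gram–Schmidt basis of `f` costs a factor of modulus one and makes the matrix
  -- triangular.
  have h1 : b.toBasis.det f = b.toBasis.det g * g.toBasis.det f := by
    rw [b.toBasis.det_apply, b.toBasis.det_apply, g.toBasis.det_apply, ← Matrix.det_mul,
      ← g.coe_toBasis, b.toBasis.toMatrix_mul_toMatrix]
  rw [h1, norm_mul, b.det_to_matrix_orthonormalBasis g, one_mul,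
    InnerProductSpace.gramSchmidtOrthonormalBasis_det, norm_prod]
  refine Finset.prod_le_prod (fun i _ => norm_nonneg _) fun i _ => ?_
  refine (norm_inner_le_norm _ _).trans ?_
  rw [g.orthonormal.1 i, one_mul]

/-- If the `y i` are independent, projecting the `x i` onto their span keeps all inner products, and
the matrix is a product of two square coordinate matrices, each bounded by Hadamard. Otherwise the
determinant vanishes. -/
theorem norm_det_inner_le_fin {n : ℕ} {H : Type*} [NormedAddCommGroup H] [InnerProductSpace ℂ H]
    (x y : Fin n → H) :
    ‖(Matrix.of fun i j => inner ℂ (x i) (y j)).det‖ ≤ ∏ i, (‖x i‖ * ‖y i‖) := by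
  by_cases hy : LinearIndependent ℂ y
  · set U := Submodule.span ℂ (Set.range y)
    have : FiniteDimensional ℂ U := FiniteDimensional.span_of_finite ℂ (Set.finite_range y)
    have h : Module.finrank ℂ U = n := by
      simpa using finrank_span_eq_card hy
    let b : OrthonormalBasis (Fin n) ℂ U :=
      (stdOrthonormalBasis ℂ U).reindex (finCongr h)
    let y' : Fin n → U := fun i => ⟨y i, Submodule.subset_span ⟨i, rfl⟩⟩
    let x' : Fin n → U := fun i => U.orthogonalProjectionOnto (x i)
    have hM : (Matrix.of fun i j => inner ℂ (x i) (y j)) =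
        (b.toBasis.toMatrix x').conjTranspose * b.toBasis.toMatrix y' := by
      ext i j
      rw [Matrix.mul_apply]
      have h1 : inner ℂ (x i) (y j) = inner ℂ (x' i) (y' j) := by
        simp [x', y']
      rw [Matrix.of_apply, h1, ← b.sum_inner_mul_inner]
      refine Finset.sum_congr rfl fun k _ => ?_
      simp [Module.Basis.toMatrix_apply, b.repr_apply_apply]
    rw [hM, Matrix.det_mul, Matrix.det_conjTranspose, norm_mul, norm_star, Finset.prod_mul_distrib]
    refine mul_le_mul ((norm_det_orthonormalBasis_le b x').trans ?_)
      (norm_det_orthonormalBasis_le b y') (norm_nonneg _)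
      (Finset.prod_nonneg fun _ _ => norm_nonneg _)
    exact Finset.prod_le_prod (fun i _ => norm_nonneg _)
      fun i _ => U.norm_orthogonalProjectionOnto_apply_le (x i)
  · obtain ⟨g, hg, i, hi⟩ := Fintype.not_linearIndependent_iff.1 hy
    have : (Matrix.of fun i j => inner ℂ (x i) (y j)).det = 0 := by
      refine Matrix.exists_mulVec_eq_zero_iff.1 ⟨g, fun h => hi (congrFun h i), ?_⟩
      ext k
      have : inner ℂ (x k) (∑ j, g j • y j) = 0 := by rw [hg, inner_zero_right]
      rw [inner_sum] at this
      simpa [Matrix.mulVec, dotProduct, inner_smul_right, mul_comm] using this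
    rw [this, norm_zero]
    exact Finset.prod_nonneg fun _ _ => by positivity

/-- Hadamard's inequality for mixed Gram determinants. -/
theorem norm_det_inner_le {ι H : Type*} [Fintype ι] [DecidableEq ι] [NormedAddCommGroup H]
    [InnerProductSpace ℂ H] (x y : ι → H) :
    ‖(Matrix.of fun i j => inner ℂ (x i) (y j)).det‖ ≤ ∏ i, (‖x i‖ * ‖y i‖) := by
  have e := (Fintype.equivFin ι).symm
  rw [← Matrix.det_submatrix_equiv_self e, ← e.prod_comp]
  exact norm_det_inner_le_fin (x ∘ e) (y ∘ e)

end LinearAlgebra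

/-! ### Series of principal minors of mixed Gram matrices -/

section GramSeries

variable {ι H : Type*} [NormedAddCommGroup H] [InnerProductSpace ℂ H]

open Classical in
/-- The principal minor with index set `T` of the mixed Gram matrix `⟪x i, y j⟫`. -/
def gramMinor (x y : ι → H) (T : Finset ι) : ℂ :=
  (Matrix.of fun i j : T => inner ℂ (x i) (y j)).det

/-- The von Koch determinant of `I + ⟪x i, y j⟫`: the sum of all principal minors. -/
def gramDet (x y : ι → H) : ℂ := ∑' T : Finset ι, gramMinor x y T

theorem norm_gramMinor_le (x y : ι → H) (T : Finset ι) :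
    ‖gramMinor x y T‖ ≤ ∏ i ∈ T, (‖x i‖ * ‖y i‖) := by
  classical
  rw [← Finset.prod_coe_sort]
  exact norm_det_inner_le (fun i : T => x i) fun i : T => y i

theorem norm_gramMinor_le_of_le {x y : ι → H} {c : ι → ℝ} (h : ∀ i, ‖x i‖ * ‖y i‖ ≤ c i)
    (T : Finset ι) : ‖gramMinor x y T‖ ≤ ∏ i ∈ T, c i :=
  (norm_gramMinor_le x y T).trans
    (Finset.prod_le_prod (fun _ _ => by positivity) fun i _ => h i)

/-- The bounds `∏ i ∈ T, c i` with `c` summable have a finite sum over all `T`, namely `∏ (1 + c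
i)`. -/
theorem hasSum_gramMinor {x y : ι → H} (h : Summable fun i => ‖x i‖ * ‖y i‖) :
    HasSum (gramMinor x y) (gramDet x y) :=
  (Summable.of_norm_bounded (summable_finsetProd_of_summable_nonneg (fun _ => by positivity) h)
    (norm_gramMinor_le x y)).hasSum

/-- Dominated convergence for Gram determinants. -/
theorem tendsto_gramDet {α : Type*} {F : Filter α} {x : ι → H} {z : α → ι → H} {y : ι → H}
    {c : ι → ℝ} (hc : Summable c) (hz : ∀ a i, ‖x i‖ * ‖z a i‖ ≤ c i)
    (h : ∀ i, Tendsto (fun a => z a i) F (𝓝 (y i))) :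
    Tendsto (fun a => gramDet x (z a)) F (𝓝 (gramDet x y)) := by
  classical
  rcases isEmpty_or_nonempty α with hα | ⟨⟨a₀⟩⟩
  · rw [Subsingleton.elim F ⊥]
    exact tendsto_bot
  have hc0 : ∀ i, 0 ≤ c i := fun i => le_trans (by positivity) (hz a₀ i)
  refine tendsto_tsum_of_dominated_convergence (summable_finsetProd_of_summable_nonneg hc0 hc)
    (fun T => ?_) (Eventually.of_forall fun a => norm_gramMinor_le_of_le (hz a))
  refine ((continuous_id.matrix_det).tendsto _).comp (tendsto_pi_nhds.2 fun i =>
    tendsto_pi_nhds.2 fun j => ?_)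
  exact tendsto_const_nhds.inner (h j)

/-- A finite determinant `det (I + M)` as a sum over subsets of a finite set of indices. -/
theorem det_one_add_inner_eq_sum_powerset (x y : ι → H) (T : Finset ι) [DecidableEq T] :
    (1 + Matrix.of fun i j : T => inner ℂ (x i) (y j)).det =
      ∑ S ∈ T.powerset, gramMinor x y S := by
  classical
  rw [det_one_add_eq_sum_minors]
  refine Finset.sum_bij' (fun s _ => s.map (Function.Embedding.subtype (· ∈ T)))
    (fun S _ => S.subtype (· ∈ T)) ?_ ?_ ?_ ?_ ?_
  · intro s _
    rw [Finset.mem_powerset]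
    intro i hi
    exact s.property_of_mem_map_subtype hi
  · simp
  · intro s _
    ext i
    simp
  · intro S hS
    exact Finset.subtype_map_of_mem fun i hi => Finset.mem_powerset.1 hS hi
  · intro s _
    let f : s → (s.map (Function.Embedding.subtype (· ∈ T)) : Finset ι) :=
      fun i => ⟨i.1.1, Finset.mem_map_of_mem _ i.2⟩
    have hf : Function.Bijective f := by
      constructor
      · intro i j hij
        exact Subtype.ext (Subtype.ext (congrArg (fun k => k.1) hij))
      · rintro ⟨i, hi⟩
        obtain ⟨j, hj, rfl⟩ := Finset.mem_map.1 hi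
        exact ⟨⟨j, hj⟩, rfl⟩
    rw [gramMinor, ← Matrix.det_submatrix_equiv_self (Equiv.ofBijective f hf)]
    rfl

/-- The infinite Weinstein–Aronszajn identity: if the `y i` are combinations of finitely many
vectors, then the Gram determinant is a finite determinant. -/
theorem det_one_add_tsum_eq_gramDet {σ : Type*} [Fintype σ] [DecidableEq σ] {x : ι → H}
    (u : σ → H) (β : ι → σ → ℂ)
    (h : Summable fun i => ‖x i‖ * ‖∑ k, β i k • u k‖) {M : Matrix σ σ ℂ}
    (hM : ∀ k l, HasSum (fun i => β i k * inner ℂ (x i) (u l)) (M k l)) :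
    (1 + M).det = gramDet x fun i => ∑ k, β i k • u k := by
  -- Both sides are limits over finite `T ⊆ ι`: the minors inside `T` add up to `det (1 + AB)`,
  -- while `det (1 + BA)` has the fixed size `σ` and converges entrywise.
  classical
  have h1 := (hasSum_gramMinor h).comp tendsto_finset_powerset_atTop_atTop
  have h2 : Tendsto (fun T : Finset ι =>
      (1 + Matrix.of fun k l => ∑ i ∈ T, β i k * inner ℂ (x i) (u l)).det) atTop
      (𝓝 (1 + M).det) := by
    refine ((continuous_id.matrix_det).tendsto _).comp (tendsto_const_nhds.add ?_)
    exact tendsto_pi_nhds.2 fun k => tendsto_pi_nhds.2 fun l => hM k l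
  refine tendsto_nhds_unique h2 (h1.congr fun T => ?_)
  rw [Function.comp_apply, ← det_one_add_inner_eq_sum_powerset]
  let B : Matrix σ T ℂ := Matrix.of fun k i => β i k
  let A : Matrix T σ ℂ := Matrix.of fun i l => inner ℂ (x i) (u l)
  have hAB : (Matrix.of fun i j : T => inner ℂ (x i) (∑ k, β j k • u k)) = A * B := by
    ext i j
    simp [A, B, Matrix.mul_apply, mul_comm]
  have hBA : (Matrix.of fun k l => ∑ i ∈ T, β i k * inner ℂ (x i) (u l)) = B * A := by
    ext k l
    simp [A, B, Matrix.mul_apply, ← Finset.sum_coe_sort T]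
  rw [hAB, hBA, Matrix.det_one_add_mul_comm]

end GramSeries

/-! ### Projections onto finite sets of basis vectors -/

section SectionProj

variable {ι H : Type*} [NormedAddCommGroup H] [InnerProductSpace ℂ H]

/-- The orthogonal projection onto the span of finitely many basis vectors. -/
def sectionProj (b : HilbertBasis ι ℂ H) (S : Finset ι) : H →L[ℂ] H :=
  ∑ k ∈ S, InnerProductSpace.rankOne ℂ (b k) (b k)

theorem sectionProj_apply (b : HilbertBasis ι ℂ H) (S : Finset ι) (v : H) :
    sectionProj b S v = ∑ k ∈ S, inner ℂ (b k) v • b k := by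
  simp [sectionProj]

theorem norm_sectionProj_apply_le (b : HilbertBasis ι ℂ H) (S : Finset ι) (v : H) :
    ‖sectionProj b S v‖ ≤ ‖v‖ := by
  refine le_of_sq_le_sq ?_ (norm_nonneg _)
  refine le_trans (le_of_eq ?_) (b.orthonormal.sum_inner_products_le v (s := S))
  have h := b.orthonormal.inner_sum (fun k => inner ℂ (b k) v) (fun k => inner ℂ (b k) v) S
  rw [← sectionProj_apply, inner_self_eq_norm_sq_to_K] at h
  simp only [Complex.conj_mul'] at h
  refine Complex.ofReal_injective ?_
  push_cast
  exact h

theorem tendsto_sectionProj (b : HilbertBasis ι ℂ H) (v : H) :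
    Tendsto (fun S => sectionProj b S v) atTop (𝓝 v) := by
  simpa [HasSum, sectionProj_apply, b.repr_apply_apply] using b.hasSum_repr v

end SectionProj

/-! ### Nuclear representations and the ideal of trace class operators -/

section Nuclear

universe u

variable {ι κ : Type*} {H : Type u} [NormedAddCommGroup H] [InnerProductSpace ℂ H]

/-- `K = ∑ ⟪x i, ·⟫ y i` is a nuclear representation of `K`. -/
def IsNuclearRep (K : H →L[ℂ] H) (x y : ι → H) : Prop :=
  (Summable fun i => ‖x i‖ * ‖y i‖) ∧ ∀ v : H, HasSum (fun i => inner ℂ (x i) v • y i) (K v)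

theorem IsNuclearRep.comp_left {K : H →L[ℂ] H} {x y : ι → H} (h : IsNuclearRep K x y)
    (B : H →L[ℂ] H) : IsNuclearRep (B * K) x fun i => B (y i) := by
  refine ⟨Summable.of_nonneg_of_le (fun _ => by positivity) (fun i => ?_) (h.1.mul_left ‖B‖),
    fun v => ?_⟩
  · calc ‖x i‖ * ‖B (y i)‖ ≤ ‖x i‖ * (‖B‖ * ‖y i‖) := by gcongr; exact B.le_opNorm _
      _ = ‖B‖ * (‖x i‖ * ‖y i‖) := by ring
  · simpa using (h.2 v).mapL B

theorem IsNuclearRep.comp_right [CompleteSpace H] {K : H →L[ℂ] H} {x y : ι → H}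
    (h : IsNuclearRep K x y) (B : H →L[ℂ] H) :
    IsNuclearRep (K * B) (fun i => ContinuousLinearMap.adjoint B (x i)) y := by
  refine ⟨Summable.of_nonneg_of_le (fun _ => by positivity) (fun i => ?_)
    (h.1.mul_left ‖ContinuousLinearMap.adjoint B‖), fun v => ?_⟩
  · calc ‖ContinuousLinearMap.adjoint B (x i)‖ * ‖y i‖
        ≤ (‖ContinuousLinearMap.adjoint B‖ * ‖x i‖) * ‖y i‖ := by
          gcongr; exact ContinuousLinearMap.le_opNorm _ _
      _ = _ := by ring
  · simpa [ContinuousLinearMap.adjoint_inner_left] using h.2 (B v)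

theorem IsNuclearRep.add {K L : H →L[ℂ] H} {x y : ι → H} {z w : κ → H}
    (h : IsNuclearRep K x y) (h' : IsNuclearRep L z w) :
    IsNuclearRep (K + L) (Sum.elim x z) (Sum.elim y w) := by
  refine ⟨?_, fun v => ?_⟩
  · exact (HasSum.sum (f := fun i : ι ⊕ κ => ‖Sum.elim x z i‖ * ‖Sum.elim y w i‖)
      h.1.hasSum h'.1.hasSum).summable
  · exact HasSum.sum (f := fun i : ι ⊕ κ => inner ℂ (Sum.elim x z i) v • Sum.elim y w i)
      (h.2 v) (h'.2 v)

theorem IsNuclearRep.isTraceClass [Countable ι] {K : H →L[ℂ] H} {x y : ι → H}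
    (h : IsNuclearRep K x y) : IsTraceClass K := by
  obtain ⟨f, hf⟩ := exists_injective_nat ι
  have hx : ∀ i, Function.extend f x 0 (f i) = x i := fun i => hf.extend_apply _ _ _
  have hy : ∀ i, Function.extend f y 0 (f i) = y i := fun i => hf.extend_apply _ _ _
  have h0 : ∀ n ∉ Set.range f, Function.extend f x 0 n = 0 := fun n hn =>
    Function.extend_apply' _ _ _ fun ⟨i, hi⟩ => hn ⟨i, hi⟩
  refine ⟨Function.extend f x 0, Function.extend f y 0, ?_, fun v => ?_⟩
  · refine (hf.summable_iff fun n hn => ?_).1 ?_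
    · simp [h0 n hn]
    · simpa [Function.comp_def, hx, hy] using h.1
  · refine (hf.hasSum_iff fun n hn => ?_).1 ?_
    · simp [h0 n hn]
    · simpa [Function.comp_def, hx, hy] using h.2 v

theorem IsTraceClass.add {K L : H →L[ℂ] H} (hK : IsTraceClass K) (hL : IsTraceClass L) :
    IsTraceClass (K + L) := by
  obtain ⟨x, y, h⟩ := hK
  obtain ⟨z, w, h'⟩ := hL
  exact (IsNuclearRep.add h h').isTraceClass

theorem IsTraceClass.mul_left {K : H →L[ℂ] H} (hK : IsTraceClass K) (B : H →L[ℂ] H) :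
    IsTraceClass (B * K) := by
  obtain ⟨x, y, h⟩ := hK
  exact (IsNuclearRep.comp_left h B).isTraceClass

theorem IsTraceClass.mul_right [CompleteSpace H] {K : H →L[ℂ] H} (hK : IsTraceClass K)
    (B : H →L[ℂ] H) : IsTraceClass (K * B) := by
  obtain ⟨x, y, h⟩ := hK
  exact (IsNuclearRep.comp_right h B).isTraceClass

theorem IsTraceClass.smul {K : H →L[ℂ] H} (hK : IsTraceClass K) (c : ℂ) :
    IsTraceClass (c • K) := by
  simpa using hK.mul_left (c • 1)

theorem IsTraceClass.neg {K : H →L[ℂ] H} (hK : IsTraceClass K) : IsTraceClass (-K) := by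
  simpa using hK.smul (-1)

theorem IsTraceClass.sub {K L : H →L[ℂ] H} (hK : IsTraceClass K) (hL : IsTraceClass L) :
    IsTraceClass (K - L) := by
  simpa [sub_eq_add_neg] using hK.add hL.neg

theorem isTraceClass_zero : IsTraceClass (0 : H →L[ℂ] H) :=
  ⟨0, 0, by simp, fun v => by simp⟩

end Nuclear

/-! ### Existence, cyclicity and multiplicativity of Fredholm determinants -/

section Fredholm

universe u

variable {ι : Type*} {β : Type u} {H : Type u} [NormedAddCommGroup H] [InnerProductSpace ℂ H]

/-- The section of `K` has entries `∑ i, ⟪b k, y i⟫ ⟪x i, b l⟫`, so the Weinstein–Aronszajn identity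
moves the determinant to the index set `ι`, where only the vectors `y i` depend on `S`. -/
theorem sectionDet_one_add {K : H →L[ℂ] H} {x y : ι → H} (h : IsNuclearRep K x y)
    (b : HilbertBasis β ℂ H) (S : Finset β) :
    sectionDet b (1 + K) S = gramDet x fun i => sectionProj b S (y i) := by
  classical
  have h1 : ∀ i, sectionProj b S (y i) = ∑ k : S, inner ℂ (b k) (y i) • b k := fun i => by
    rw [sectionProj_apply, ← Finset.sum_coe_sort S]
  simp only [h1]
  rw [← det_one_add_tsum_eq_gramDet (fun k : S => b k) (fun i k => inner ℂ (b k) (y i))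
    (M := Matrix.of fun k l : S => inner ℂ (b k) (K (b l)))]
  · rw [sectionDet]
    congr!
    ext k l
    rw [Matrix.add_apply, Matrix.of_apply, Matrix.of_apply, add_apply,
      inner_add_right, one_apply_eq_self, orthonormal_iff_ite.1 b.orthonormal,
      Matrix.one_apply]
    simp only [SetLike.coe_eq_coe]
  · refine Summable.of_nonneg_of_le (fun _ => by positivity) (fun i => ?_) h.1
    rw [← h1]
    gcongr
    exact norm_sectionProj_apply_le b S _
  · intro k l
    have := (h.2 (b l)).mapL (innerSL ℂ (b k))
    simpa [inner_smul_right, mul_comm] using this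

theorem inner_sectionProj (b : HilbertBasis β ℂ H) {S : Finset β} {i : β} (hi : i ∈ S) (v : H) :
    inner ℂ (b i) (sectionProj b S v) = inner ℂ (b i) v := by
  rw [sectionProj_apply, b.orthonormal.inner_right_sum _ hi]

theorem sectionProj_basis (b : HilbertBasis β ℂ H) {S : Finset β} {j : β} (hj : j ∈ S) :
    sectionProj b S (b j) = b j := by
  classical
  rw [sectionProj_apply, Finset.sum_eq_single j]
  · rw [orthonormal_iff_ite.1 b.orthonormal, if_pos rfl, one_smul]
  · intro k _ hk
    rw [orthonormal_iff_ite.1 b.orthonormal, if_neg hk, zero_smul]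
  · exact fun h => absurd hj h

theorem sectionProj_mul_self (b : HilbertBasis β ℂ H) (S : Finset β) :
    sectionProj b S * sectionProj b S = sectionProj b S := by
  ext v
  change sectionProj b S (sectionProj b S v) = _
  rw [sectionProj_apply b S (sectionProj b S v), sectionProj_apply b S v]
  refine Finset.sum_congr rfl fun k hk => ?_
  rw [← sectionProj_apply, inner_sectionProj b hk]

theorem sectionDet_congr {b : HilbertBasis β ℂ H} {S : Finset β} {A B : H →L[ℂ] H}
    (h : sectionProj b S * A * sectionProj b S = sectionProj b S * B * sectionProj b S) :
    sectionDet b A S = sectionDet b B S := by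
  unfold sectionDet
  congr 1
  ext i j
  have h1 : ∀ C : H →L[ℂ] H, inner ℂ (b i) (C (b j)) =
      inner ℂ (b i) ((sectionProj b S * C * sectionProj b S) (b j)) := fun C => by
    change _ = inner ℂ (b i) (sectionProj b S (C (sectionProj b S (b j))))
    rw [inner_sectionProj b i.2, sectionProj_basis b j.2]
  rw [Matrix.of_apply, Matrix.of_apply, h1 A, h1 B, h]

theorem sectionDet_mul (b : HilbertBasis β ℂ H) (S : Finset β) (A B : H →L[ℂ] H) :
    sectionDet b A S * sectionDet b B S = sectionDet b (A * sectionProj b S * B) S := by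
  classical
  rw [sectionDet, sectionDet, sectionDet, ← Matrix.det_mul]
  congr 1
  ext i j
  rw [Matrix.mul_apply]
  change _ = inner ℂ (b i) (A (sectionProj b S (B (b j))))
  simp only [Matrix.of_apply, sectionProj_apply, map_sum, map_smul, inner_sum, inner_smul_right]
  rw [← Finset.sum_coe_sort S]
  exact Finset.sum_congr rfl fun k _ => mul_comm _ _

/-- The limit does not involve `b`, so one value serves all bases. -/
theorem tendsto_sectionDet {K : H →L[ℂ] H} {x y : ι → H} (h : IsNuclearRep K x y)
    (b : HilbertBasis β ℂ H) :
    Tendsto (sectionDet b (1 + K)) atTop (𝓝 (gramDet x y)) := by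
  rw [show sectionDet b (1 + K) = _ from funext (sectionDet_one_add h b)]
  refine tendsto_gramDet h.1 (fun S i => ?_) fun i => tendsto_sectionProj b (y i)
  gcongr
  exact norm_sectionProj_apply_le b S _

theorem IsNuclearRep.hasFredholmDet [Countable ι] {K : H →L[ℂ] H} {x y : ι → H}
    (h : IsNuclearRep K x y) : HasFredholmDet (1 + K) (gramDet x y) :=
  ⟨by simpa using h.isTraceClass, fun _ b => tendsto_sectionDet h b⟩

/-- Fredholm determinants exist. -/
theorem IsTraceClass.exists_hasFredholmDet {K : H →L[ℂ] H} (hK : IsTraceClass K) :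
    ∃ d, HasFredholmDet (1 + K) d := by
  obtain ⟨x, y, h⟩ := hK
  exact ⟨_, IsNuclearRep.hasFredholmDet h⟩

theorem hasFredholmDet_one : HasFredholmDet (1 : H →L[ℂ] H) 1 := by
  classical
  refine ⟨by simpa using isTraceClass_zero, fun ι b => ?_⟩
  refine tendsto_const_nhds.congr fun S => ?_
  unfold sectionDet
  refine Matrix.det_one.symm.trans (congrArg Matrix.det ?_)
  ext i j
  rw [Matrix.of_apply, one_apply_eq_self, orthonormal_iff_ite.1 b.orthonormal,
    Matrix.one_apply]
  simp only [SetLike.coe_eq_coe]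

/-- `det (I + A B) = det (I + B A)`. -/
theorem HasFredholmDet.comm [CompleteSpace H] {A B : H →L[ℂ] H} {d : ℂ} (hA : IsTraceClass A)
    (h : HasFredholmDet (1 + A * B) d) : HasFredholmDet (1 + B * A) d := by
  obtain ⟨x, y, hxy⟩ := hA
  -- The two representations have the same mixed Gram matrix, since `⟪B* x i, y j⟫ = ⟪x i, B y j⟫`.
  have h1 := (IsNuclearRep.comp_right hxy B).hasFredholmDet
  have h2 := (IsNuclearRep.comp_left hxy B).hasFredholmDet
  rw [h.unique h1]
  convert! h2 using 1
  simp [gramDet, gramMinor, ContinuousLinearMap.adjoint_inner_left]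

/-- The Fredholm determinant is multiplicative. -/
theorem HasFredholmDet.mul [CompleteSpace H] {A B : H →L[ℂ] H} {d e : ℂ}
    (hA : HasFredholmDet A d) (hB : HasFredholmDet B e) : HasFredholmDet (A * B) (d * e) := by
  obtain ⟨x, y, hxy⟩ := hA.1
  obtain ⟨z, w, hzw⟩ := hB.1
  obtain ⟨K, rfl⟩ : ∃ K, A = 1 + K := ⟨A - 1, by abel⟩
  obtain ⟨L, rfl⟩ : ∃ L, B = 1 + L := ⟨B - 1, by abel⟩
  rw [add_sub_cancel_left] at hxy hzw
  have hK : IsNuclearRep K x y := hxy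
  have hL : IsNuclearRep L z w := hzw
  have h1 : (1 + K) * (1 + L) = 1 + (K + (1 + K) * L) := by noncomm_ring
  have hAB := (hK.add (hL.comp_left (1 + K))).hasFredholmDet
  rw [← h1] at hAB
  suffices d * e = gramDet (Sum.elim x z) (Sum.elim y fun i => (1 + K) (w i)) by rwa [this]
  obtain ⟨β, b, -⟩ := exists_hilbertBasis ℂ H
  refine tendsto_nhds_unique ((hA.2 _ b).mul (hB.2 _ b)) ?_
  -- With `P` the section projection, the product of sections is the section of `(1 + K)P(1 + L)`,
  -- which has the same compression as `1 + K + (1 + KP)L`. The resulting Gram vectors converge to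
  -- those of `AB`.
  have h2 : ∀ S, sectionDet b (1 + K) S * sectionDet b (1 + L) S =
      gramDet (Sum.elim x z) fun i => sectionProj b S
        (Sum.elim y (fun i => (1 + K * sectionProj b S) (w i)) i) := by
    intro S
    rw [← sectionDet_one_add (hK.add (hL.comp_left (1 + K * sectionProj b S))), sectionDet_mul]
    refine sectionDet_congr ?_
    have hP := sectionProj_mul_self b S
    set P := sectionProj b S
    calc P * ((1 + K) * P * (1 + L)) * P
        = P * P * P + P * K * (P * P) + (P * P) * L * P + P * K * P * L * P := by noncomm_ring
      _ = P * P + P * K * P + P * L * P + P * K * P * L * P := by rw [hP, hP]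
      _ = _ := by noncomm_ring
  refine Tendsto.congr (fun S => (h2 S).symm) ?_
  refine tendsto_gramDet (c := Sum.elim (fun i => ‖x i‖ * ‖y i‖)
    fun i => (1 + ‖K‖) * (‖z i‖ * ‖w i‖)) ?_ ?_ ?_
  · exact (HasSum.sum (f := Sum.elim (fun i => ‖x i‖ * ‖y i‖)
      fun i => (1 + ‖K‖) * (‖z i‖ * ‖w i‖)) hxy.1.hasSum (hzw.1.mul_left _).hasSum).summable
  · rintro S (i | i)
    · dsimp only [Sum.elim_inl]
      gcongr
      exact norm_sectionProj_apply_le b S _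
    · dsimp only [Sum.elim_inr]
      have h3 : ‖sectionProj b S ((1 + K * sectionProj b S) (w i))‖ ≤ (1 + ‖K‖) * ‖w i‖ := by
        refine (norm_sectionProj_apply_le b S _).trans ?_
        refine (norm_add_le _ _).trans ?_
        rw [add_mul, one_mul]
        refine add_le_add le_rfl ((K.le_opNorm _).trans ?_)
        gcongr
        exact norm_sectionProj_apply_le b S _
      calc _ ≤ ‖z i‖ * ((1 + ‖K‖) * ‖w i‖) := by gcongr
        _ = _ := by ring
  · rintro (i | i)
    · exact tendsto_sectionProj b (y i)
    · have h4 : Tendsto (fun S => (1 + K * sectionProj b S) (w i)) atTop (𝓝 ((1 + K) (w i))) :=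
        tendsto_const_nhds.add ((K.continuous.tendsto _).comp (tendsto_sectionProj b (w i)))
      -- Split `P v_S - v = P(v_S - v) + (Pv - v)`, where `P` is a contraction.
      refine tendsto_iff_norm_sub_tendsto_zero.2 ?_
      refine squeeze_zero (fun _ => norm_nonneg _) (fun S => ?_)
        ((tendsto_iff_norm_sub_tendsto_zero.1 h4).add
          (tendsto_iff_norm_sub_tendsto_zero.1 (tendsto_sectionProj b ((1 + K) (w i)))) |>.trans
          (by simp))
      dsimp only [Sum.elim_inr]
      refine le_trans (le_of_eq (congrArg norm ?_)) ((norm_add_le (sectionProj b S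
        ((1 + K * sectionProj b S) (w i) - (1 + K) (w i))) _).trans
        (add_le_add (norm_sectionProj_apply_le b S _) le_rfl))
      rw [map_sub]
      abel

end Fredholm

/-! ### Determinants of triangular perturbations of the identity -/

section Abstract

variable {H : Type*} [NormedAddCommGroup H] [InnerProductSpace ℂ H] [CompleteSpace H]

theorem HasFredholmDet.comm' {A B : H →L[ℂ] H} {d : ℂ} (hB : IsTraceClass B)
    (h : HasFredholmDet (1 + A * B) d) : HasFredholmDet (1 + B * A) d := by
  obtain ⟨e, he⟩ := (hB.mul_right A).exists_hasFredholmDet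
  rwa [h.unique (he.comm hB)]

/-- The Fredholm determinant is invariant under similarity. -/
theorem HasFredholmDet.conj {T U V : H →L[ℂ] H} {d : ℂ} (h : HasFredholmDet T d)
    (hUV : U * V = 1) (hVU : V * U = 1) : HasFredholmDet (U * T * V) d := by
  have h1 : T = 1 + ((T - 1) * V) * U := by rw [mul_assoc, hVU]; noncomm_ring
  have h2 : U * T * V = 1 + U * ((T - 1) * V) := by
    calc U * T * V = U * V + U * ((T - 1) * V) := by noncomm_ring
      _ = _ := by rw [hUV]
  rw [h2]
  exact HasFredholmDet.comm (h.1.mul_right V) (h1 ▸ h)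

/-- Cyclicity: `det (1 + XP) = det (1 + PX) = det 1`. -/
theorem hasFredholmDet_one_of_mul_right {X P : H →L[ℂ] H} (hX : IsTraceClass X) (h1 : X * P = X)
    (h2 : P * X = 0) : HasFredholmDet (1 + X) 1 := by
  have := HasFredholmDet.comm' (A := P) hX (by rw [h2, add_zero]; exact hasFredholmDet_one)
  rwa [h1] at this

theorem hasFredholmDet_one_of_mul_left {X P : H →L[ℂ] H} (hX : IsTraceClass X) (h1 : P * X = X)
    (h2 : X * P = 0) : HasFredholmDet (1 + X) 1 := by
  have := HasFredholmDet.comm (B := P) hX (by rw [h2, add_zero]; exact hasFredholmDet_one)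
  rwa [h1] at this

theorem mul_self_eq_zero_of_mul_right {A : Type*} [Ring A] {X P : A} (h1 : X * P = X) (h2 : P * X = 0) :
    X * X = 0 := by
  rw [← h1, mul_assoc, ← mul_assoc P, h2, zero_mul, mul_zero]

variable {P R X Y : H →L[ℂ] H}

/-- Two triangular perturbations of the identity: `det (I + X - Y) = det (I + X Y)`. -/
theorem exists_hasFredholmDet_add_sub (hX : IsTraceClass X) (hY : IsTraceClass Y)
    (hXP : X * P = X) (hPX : P * X = 0) (hRY : R * Y = Y) (hYR : Y * R = 0) :
    ∃ δ, HasFredholmDet (1 + X - Y) δ ∧ HasFredholmDet (1 + X * Y) δ := by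
  obtain ⟨δ, h⟩ := (hX.sub hY).exists_hasFredholmDet
  obtain ⟨ε, h'⟩ := (hX.mul_right Y).exists_hasFredholmDet
  rw [← add_sub_assoc] at h
  have hXX := mul_self_eq_zero_of_mul_right hXP hPX
  have hYY : Y * Y = 0 := by
    nth_rewrite 2 [← hRY]
    rw [← mul_assoc, hYR, zero_mul]
  -- As `X² = Y² = 0`, both `(1 + X - Y)(1 + Y)` and `(1 + X)(1 + XY)` equal `1 + X + XY`, and the
  -- factors `1 + Y` and `1 + X` have determinant one.
  have h1 := h.mul (hasFredholmDet_one_of_mul_left hY hRY hYR)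
  have h2 := (hasFredholmDet_one_of_mul_right hX hXP hPX).mul h'
  have h3 : (1 + X - Y) * (1 + Y) = (1 + X) * (1 + X * Y) := by
    have : (1 + X - Y) * (1 + Y) - (1 + X) * (1 + X * Y) = - (Y * Y) - X * X * Y := by
      noncomm_ring
    rw [← sub_eq_zero, this, hXX, hYY]
    simp
  rw [h3] at h1
  have h4 : δ = ε := by simpa using h1.unique h2
  exact ⟨δ, h, h4 ▸ h'⟩

/-- The triangular form of the determinant identity when `R ≤ P`. -/
theorem hasFredholmDet_triangular_of_le (hX : IsTraceClass X) (hY : IsTraceClass Y)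
    (hXP : X * P = X) (hPX : P * X = 0) (hRY : R * Y = Y) (hYR : Y * R = 0) (hR : R * R = R)
    (hPR : P * R = R) (hRP : R * P = R) {s e : ℂ} (hM : HasFredholmDet (1 + s • (P - R)) e) :
    ∃ δ, HasFredholmDet (1 + s • P - s • R + X - Y) (e * δ) ∧
      HasFredholmDet (1 - (s • (1 - P) - X) * (s • R + Y)) δ := by
  obtain ⟨δ, h1, h2⟩ := exists_hasFredholmDet_add_sub hX hY hXP hPX hRY hYR
  have hRX : R * X = 0 := by rw [← hRP, mul_assoc, hPX, mul_zero]
  have hPY : P * Y = Y := by rw [← hRY, ← mul_assoc, hPR]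
  refine ⟨δ, ?_, ?_⟩
  · convert hM.mul h1 using 1
    have : (1 + s • (P - R)) * (1 + X - Y) =
        1 + s • P - s • R + X - Y + s • (P * X - R * X - P * Y + R * Y) := by
      simp only [mul_add, add_mul, mul_sub, smul_mul_assoc, sub_mul, mul_one, one_mul]
      module
    rw [this, hPX, hRX, hPY, hRY]
    simp
  -- `1 - P` kills `R` and `Y`, which leaves `1 + sXR + XY`; it factors as `(1 + sXR)(1 + XY)`
  -- because `RX = 0`.
  · have h3 : HasFredholmDet (1 + s • (X * R)) 1 :=
      hasFredholmDet_one_of_mul_right (P := R) ((hX.mul_right R).smul s)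
        (by rw [smul_mul_assoc, mul_assoc, hR])
        (by rw [mul_smul_comm, ← mul_assoc, hRX, zero_mul, smul_zero])
    convert h3.mul h2 using 1
    · have h4 : (1 + s • (X * R)) * (1 + X * Y) =
          1 + s • (X * R) + X * Y + s • (X * (R * X) * Y) := by
        simp only [mul_add, add_mul, smul_mul_assoc, mul_one, one_mul, mul_assoc]
        module
      have h5 : (s • (1 - P) - X) * (s • R + Y) =
          (s ^ 2) • (R - P * R) + s • (Y - P * Y) - s • (X * R) - X * Y := by
        simp only [mul_add, smul_mul_assoc, sub_mul, one_mul, mul_smul_comm, smul_sub]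
        module
      rw [h4, h5, hRX, hPR, hPY]
      simp only [sub_self, smul_zero, mul_zero, zero_mul]
      abel
    · rw [one_mul]

/-- The triangular form of the determinant identity when `P ≤ R`. -/
theorem hasFredholmDet_triangular_of_ge (hX : IsTraceClass X) (hY : IsTraceClass Y)
    (hXP : X * P = X) (hPX : P * X = 0) (hRY : R * Y = Y) (hYR : Y * R = 0) (hP : P * P = P)
    (hR : R * R = R) (hPR : P * R = P) (hRP : R * P = P) {s e e' : ℂ} (hM : HasFredholmDet (1 - s • (R - P)) e)
    (hM' : HasFredholmDet (1 - s ^ 2 • (R - P)) e') :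
    ∃ δ, HasFredholmDet (1 + s • P - s • R + X - Y) (δ * e) ∧
      HasFredholmDet (1 - (s • (1 - P) - X) * (s • R + Y)) (δ * e') := by
  obtain ⟨δ, h1, h2⟩ := exists_hasFredholmDet_add_sub hX hY hXP hPX hRY hYR
  have hXR : X * R = X := by rw [← hXP, mul_assoc, hPR]
  have hYP : Y * P = 0 := by rw [← hRP, ← mul_assoc, hYR, zero_mul]
  have hXX := mul_self_eq_zero_of_mul_right hXP hPX
  -- Since `XM = YM = 0`, the first operator is `(1 + X - Y)(1 - sM)` and the second is `(1 + sX)(1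
  -- + XY)(1 - sMY)(1 - s²M)`.
  obtain ⟨M, hMdef⟩ : ∃ M, M = R - P := ⟨_, rfl⟩
  have hXM : X * M = 0 := by rw [hMdef, mul_sub, hXR, hXP, sub_self]
  have hYM : Y * M = 0 := by rw [hMdef, mul_sub, hYR, hYP, sub_self]
  have hMM : M * M = M := by
    rw [hMdef, mul_sub, sub_mul, sub_mul, hR, hPR, hRP, hP]
    abel
  rw [← hMdef] at hM hM'
  refine ⟨δ, ?_, ?_⟩
  · convert h1.mul hM using 1
    have : (1 + X - Y) * (1 - s • M) = 1 - s • M + X - Y - s • (X * M - Y * M) := by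
      simp only [add_mul, mul_sub, mul_smul_comm, sub_mul, mul_one, one_mul]
      module
    rw [this, hXM, hYM, hMdef]
    module
  · have h3 : HasFredholmDet (1 + s • X) 1 :=
      hasFredholmDet_one_of_mul_right (P := P) (hX.smul s) (by rw [smul_mul_assoc, hXP])
        (by rw [mul_smul_comm, hPX, smul_zero])
    have h4 : HasFredholmDet (1 + (-s) • (M * Y)) 1 :=
      hasFredholmDet_one_of_mul_left (P := M) ((hY.mul_left M).smul (-s))
        (by rw [mul_smul_comm, ← mul_assoc, hMM])
        (by rw [smul_mul_assoc, mul_assoc, hYM, mul_zero, smul_zero])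
    have h5 := ((h3.mul h2).mul h4).mul hM'
    rw [one_mul, mul_one] at h5
    convert h5 using 1
    have h6 : (1 + s • X) * (1 + X * Y) = 1 + s • X + X * Y := by
      have : (1 + s • X) * (1 + X * Y) = 1 + s • X + X * Y + s • (X * X * Y) := by
        simp only [mul_add, add_mul, smul_mul_assoc, mul_one, one_mul, mul_assoc]
        module
      rw [this, hXX, zero_mul, smul_zero, add_zero]
    have h7 : (1 + s • X + X * Y) * (1 + (-s) • (M * Y)) =
        1 + s • X + X * Y - s • (M * Y) := by
      have : (1 + s • X + X * Y) * (1 + (-s) • (M * Y)) = 1 + s • X + X * Y - s • (M * Y)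
          - (s ^ 2) • (X * M * Y) - s • (X * (Y * M) * Y) := by
        simp only [mul_add, add_mul, smul_mul_assoc, mul_smul_comm, mul_one, one_mul, mul_assoc]
        module
      rw [this, hXM, hYM]
      simp
    have h8 : (1 + s • X + X * Y - s • (M * Y)) * (1 - s ^ 2 • M) =
        1 + s • X + X * Y - s • (M * Y) - s ^ 2 • M := by
      have : (1 + s • X + X * Y - s • (M * Y)) * (1 - s ^ 2 • M) =
          1 + s • X + X * Y - s • (M * Y) - s ^ 2 • M - s ^ 3 • (X * M) - s ^ 2 • (X * (Y * M))
            + s ^ 3 • (M * (Y * M)) := by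
        simp only [mul_sub, sub_mul, add_mul, smul_mul_assoc, mul_smul_comm, mul_one, one_mul,
          mul_assoc]
        module
      rw [this, hXM, hYM]
      simp
    have h9 : (s • (1 - P) - X) * (s • R + Y) =
        (s ^ 2) • (R - P * R) + s • (R * Y - P * Y) - s • (X * R) - X * Y := by
      rw [hRY]
      simp only [mul_add, smul_mul_assoc, sub_mul, one_mul, mul_smul_comm, smul_sub]
      module
    rw [h6, h7, h8, h9, hPR, hXR, hMdef, sub_mul]
    module

end Abstract

/-! ### The determinant identity for a factored operator -/

section Factorization

variable {H : Type*} [NormedAddCommGroup H] [InnerProductSpace ℂ H] [CompleteSpace H]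

/-- The determinant identity for `A = U₁ U₂`, where `U₁` and its inverse `V₁` preserve the kernel
of `P`, and `U₂` and its inverse `V₂` preserve the range of `R`. -/
theorem exists_hasFredholmDet_of_factorization {P R U₁ V₁ U₂ V₂ : H →L[ℂ] H} (hP : P * P = P)
    (hR : R * R = R) (hUV₁ : U₁ * V₁ = 1) (hVU₁ : V₁ * U₁ = 1) (hUV₂ : U₂ * V₂ = 1)
    (hVU₂ : V₂ * U₂ = 1) (hU₁ : P * U₁ * (1 - P) = 0) (hV₁ : P * V₁ * (1 - P) = 0)
    (hU₂ : (1 - R) * U₂ * R = 0) (hV₂ : (1 - R) * V₂ * R = 0)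
    (hX : IsTraceClass ((1 - P) * V₁ * P)) (hY : IsTraceClass (R * V₂ * (1 - R)))
    (s : ℂ) (m : ℤ)
    (hm : (P * R = R ∧ R * P = R ∧ ∀ c : ℂ, HasFredholmDet (1 + c • (P - R)) ((1 + c) ^ m)) ∨
      (P * R = P ∧ R * P = P ∧ ∀ c : ℂ, HasFredholmDet (1 + c • (R - P)) ((1 + c) ^ (-m)))) :
    ∃ d d₁ : ℂ, HasFredholmDet (1 + s • P - s • (U₁ * U₂ * R * (V₂ * V₁))) d ∧
      HasFredholmDet (1 - s ^ 2 • (R * (V₂ * V₁) * (1 - P) * (U₁ * U₂) * R)) d₁ ∧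
      (s ≠ -1 → d = (1 + s) ^ m * d₁) := by
  obtain ⟨X, hXdef⟩ : ∃ X, X = V₁ * P * U₁ - P := ⟨_, rfl⟩
  obtain ⟨Y, hYdef⟩ : ∃ Y, Y = U₂ * R * V₂ - R := ⟨_, rfl⟩
  have hU₁' : P * U₁ = P * U₁ * P := by
    rwa [mul_sub, mul_one, sub_eq_zero] at hU₁
  have hV₁' : P * V₁ = P * V₁ * P := by
    rwa [mul_sub, mul_one, sub_eq_zero] at hV₁
  have hU₂' : U₂ * R = R * U₂ * R := by
    rwa [sub_mul, sub_mul, one_mul, sub_eq_zero] at hU₂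
  have hV₂' : V₂ * R = R * V₂ * R := by
    rwa [sub_mul, sub_mul, one_mul, sub_eq_zero] at hV₂
  have hPX : P * X = 0 := by
    rw [hXdef, mul_sub, ← mul_assoc, ← mul_assoc, ← hV₁', mul_assoc, hVU₁, mul_one, hP, sub_self]
  have hXP : X * P = X := by
    rw [hXdef, sub_mul, hP, mul_assoc, mul_assoc, ← mul_assoc P, ← hU₁', mul_assoc]
  have hRY : R * Y = Y := by
    rw [hYdef, mul_sub, hR, ← mul_assoc, ← mul_assoc, ← hU₂']
  have hYR : Y * R = 0 := by
    rw [hYdef, sub_mul, mul_assoc, mul_assoc, ← mul_assoc R, ← hV₂', ← mul_assoc, hUV₂, one_mul, hR,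
      sub_self]
  -- `PX = 0` lets `1 - P` be inserted on the left, exposing the Hankel block of `V₁`; `YR = 0` does
  -- the same for `Y` on the right.
  have tX : IsTraceClass X := by
    have : X = (1 - P) * V₁ * P * U₁ := by
      calc X = (1 - P) * X := by rw [sub_mul, hPX, one_mul, sub_zero]
        _ = (1 - P) * V₁ * P * U₁ - (P - P * P) := by rw [hXdef]; noncomm_ring
        _ = _ := by rw [hP, sub_self, sub_zero]
    rw [this]
    exact hX.mul_right _
  have tY : IsTraceClass Y := by
    have : Y = U₂ * (R * V₂ * (1 - R)) := by
      calc Y = Y * (1 - R) := by rw [mul_sub, hYR, mul_one, sub_zero]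
        _ = U₂ * (R * V₂ * (1 - R)) - (R - R * R) := by rw [hYdef]; noncomm_ring
        _ = _ := by rw [hR, sub_self, sub_zero]
    rw [this]
    exact hY.mul_left _
  have key : ∃ d d₁ : ℂ, HasFredholmDet (1 + s • P - s • R + s • X - s • Y) d ∧
      HasFredholmDet (1 - (s • (1 - P) - s • X) * (s • R + s • Y)) d₁ ∧
      (s ≠ -1 → d = (1 + s) ^ m * d₁) := by
    have h1 : s • X * P = s • X := by rw [smul_mul_assoc, hXP]
    have h2 : P * s • X = 0 := by rw [mul_smul_comm, hPX, smul_zero]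
    have h3 : R * s • Y = s • Y := by rw [mul_smul_comm, hRY]
    have h4 : s • Y * R = 0 := by rw [smul_mul_assoc, hYR, smul_zero]
    rcases hm with ⟨hPR, hRP, hM⟩ | ⟨hPR, hRP, hM⟩
    · obtain ⟨δ, hδ, hδ'⟩ := hasFredholmDet_triangular_of_le (tX.smul s) (tY.smul s) h1 h2 h3 h4 hR
        hPR hRP (hM s)
      exact ⟨_, _, hδ, hδ', fun _ => rfl⟩
    · have h5 := hM (-s)
      have h6 := hM (-s ^ 2)
      rw [neg_smul, ← sub_eq_add_neg, ← sub_eq_add_neg] at h5 h6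
      obtain ⟨δ, hδ, hδ'⟩ := hasFredholmDet_triangular_of_ge (tX.smul s) (tY.smul s) h1 h2 h3 h4 hP
        hR hPR hRP h5 h6
      refine ⟨_, _, hδ, hδ', fun hs => ?_⟩
      -- The exponent `-m` sits on `1 - s` in `d` and on `1 - s² = (1 + s)(1 - s)` in `d₁`;
      -- comparing them requires cancelling `(1 + s)^m (1 + s)^(-m)`.
      have hs' : 1 + s ≠ 0 := fun h => hs (by linear_combination h)
      rw [show 1 - s ^ 2 = (1 + s) * (1 - s) by ring, mul_zpow, mul_left_comm, zpow_neg (1 + s),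
        mul_inv_cancel_left₀ (zpow_ne_zero _ hs')]
  obtain ⟨d, d₁, hd, hd₁, h⟩ := key
  refine ⟨d, d₁, ?_, ?_, h⟩
  · convert hd.conj hUV₁ hVU₁ using 1
    have h1 : 1 + s • P - s • R + s • X - s • Y = 1 + s • (V₁ * P * U₁) - s • (U₂ * R * V₂) := by
      rw [hXdef, hYdef]; module
    have h2 : U₁ * (1 + s • (V₁ * P * U₁) - s • (U₂ * R * V₂)) * V₁ =
        U₁ * V₁ + s • ((U₁ * V₁) * P * (U₁ * V₁)) - s • (U₁ * U₂ * R * (V₂ * V₁)) := by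
      simp only [mul_add, add_mul, mul_sub, sub_mul, mul_smul_comm, smul_mul_assoc, mul_assoc,
        mul_one]
    rw [h1, h2, hUV₁, one_mul, mul_one]
  -- `B` is chosen so that `1 + (R V₂)B` is the operator wanted, while `1 + B(R V₂)` is the
  -- triangular one.
  · obtain ⟨B, hB⟩ : ∃ B, B = -(s ^ 2 • (V₁ * (1 - P) * U₁ * U₂ * R)) := ⟨_, rfl⟩
    have hQ : V₁ * (1 - P) * U₁ = 1 - P - X := by
      rw [hXdef, mul_sub, sub_mul, mul_one, hVU₁]; abel
    have hRY' : U₂ * R * V₂ = R + Y := by rw [hYdef]; abel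
    have hBA : B * (R * V₂) = -((s • (1 - P) - s • X) * (s • R + s • Y)) := by
      calc B * (R * V₂) = -(s ^ 2 • (V₁ * (1 - P) * U₁ * (U₂ * (R * R) * V₂))) := by
            rw [hB]; simp only [neg_mul, smul_mul_assoc, mul_assoc]
        _ = _ := by
          rw [hR, hQ, hRY', ← smul_sub, ← smul_add, smul_mul_smul_comm, sq]
    have hBA1 : HasFredholmDet (1 + B * (R * V₂)) d₁ := by
      rw [hBA, ← sub_eq_add_neg]; exact hd₁
    -- Cyclicity needs a trace class factor. Since `BR = B`, multiplying the trace class operator `B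
    -- R V₂` by `U₂` recovers `B`.
    have tB : IsTraceClass B := by
      have h1 : IsTraceClass (B * (R * V₂)) := by simpa using hBA1.1
      have h2 : B = B * (R * V₂) * U₂ := by
        have : B * R = B := by rw [hB, neg_mul, smul_mul_assoc, mul_assoc, hR]
        rw [mul_assoc, mul_assoc, hVU₂, mul_one, this]
      rw [h2]
      exact h1.mul_right _
    convert hBA1.comm tB using 1
    rw [hB, mul_neg, ← sub_eq_add_neg, mul_smul_comm]
    simp only [mul_assoc]

end Factorization

variable {N : ℕ}

/-! ### Multiplicativity of block Laurent operators -/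

section Laurent

theorem mulOp_apply_ae {f : UCircle → ℂ} (hf : MemLp f ∞ haarT) (x : Lp ℂ 2 haarT) :
    mulOp f x =ᵐ[haarT] fun t => f t * x t := by
  rw [mulOp, dif_pos hf]
  have h3 := ContinuousLinearMap.coeFn_holder (r := 2) (ContinuousLinearMap.mul ℂ ℂ) hf.toLp x
  filter_upwards [h3, hf.coeFn_toLp] with t h3 h4
  rw [ContinuousLinearMap.holderL_apply_apply, h3, h4, ContinuousLinearMap.mul_apply']

theorem mulOp_congr {f g : UCircle → ℂ} (hf : MemLp f ∞ haarT) (h : f =ᵐ[haarT] g) :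
    mulOp f = mulOp g := by
  ext1 x
  refine Lp.ext ?_
  filter_upwards [mulOp_apply_ae hf x, mulOp_apply_ae (hf.ae_eq h) x, h] with t h1 h2 h3
  rw [h1, h2, h3]

theorem mulOp_mul {f g : UCircle → ℂ} (hf : MemLp f ∞ haarT) (hg : MemLp g ∞ haarT) :
    mulOp (f * g) = mulOp f ∘L mulOp g := by
  ext1 x
  refine Lp.ext ?_
  filter_upwards [mulOp_apply_ae (hg.mul hf) x, mulOp_apply_ae hf (mulOp g x),
    mulOp_apply_ae hg x] with t h1 h2 h3
  rw [h1, ContinuousLinearMap.comp_apply, h2, h3, Pi.mul_apply, mul_assoc]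

theorem mulOp_add {f g : UCircle → ℂ} (hf : MemLp f ∞ haarT) (hg : MemLp g ∞ haarT) :
    mulOp (f + g) = mulOp f + mulOp g := by
  ext1 x
  refine Lp.ext ?_
  rw [add_apply]
  filter_upwards [mulOp_apply_ae (hf.add hg) x, mulOp_apply_ae hf x,
    mulOp_apply_ae hg x, Lp.coeFn_add (mulOp f x) (mulOp g x)] with t h1 h2 h3 h4
  rw [h1, h4, Pi.add_apply, Pi.add_apply, h2, h3, add_mul]

theorem mulOp_zero : mulOp 0 = 0 := by
  ext1 x
  refine Lp.ext ?_
  filter_upwards [mulOp_apply_ae (f := 0) MemLp.zero x, Lp.coeFn_zero ℂ 2 haarT] with t h1 _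
  simp [h1]

theorem mulOp_one : mulOp 1 = 1 := by
  ext1 x
  refine Lp.ext ?_
  filter_upwards [mulOp_apply_ae (f := 1) (memLp_const 1) x] with t h1
  simp [h1]

theorem scalarLaurent_congr {f g : UCircle → ℂ} (hf : MemLp f ∞ haarT) (h : f =ᵐ[haarT] g) :
    scalarLaurent f = scalarLaurent g := by
  rw [scalarLaurent, mulOp_congr hf h, scalarLaurent]

theorem scalarLaurent_mul {f g : UCircle → ℂ} (hf : MemLp f ∞ haarT) (hg : MemLp g ∞ haarT) :
    scalarLaurent (f * g) = scalarLaurent f ∘L scalarLaurent g := by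
  rw [scalarLaurent, mulOp_mul hf hg]
  ext1 x
  simp [scalarLaurent]

theorem scalarLaurent_add {f g : UCircle → ℂ} (hf : MemLp f ∞ haarT) (hg : MemLp g ∞ haarT) :
    scalarLaurent (f + g) = scalarLaurent f + scalarLaurent g := by
  rw [scalarLaurent, mulOp_add hf hg]
  ext1 x
  simp [scalarLaurent]

theorem scalarLaurent_zero : scalarLaurent 0 = 0 := by
  rw [scalarLaurent, mulOp_zero]
  ext1 x
  simp

theorem scalarLaurent_one : scalarLaurent 1 = 1 := by
  rw [scalarLaurent, mulOp_one]
  ext1 x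
  simp

theorem scalarLaurent_sum {α : Type*} (s : Finset α) {f : α → UCircle → ℂ}
    (hf : ∀ i ∈ s, MemLp (f i) ∞ haarT) :
    scalarLaurent (∑ i ∈ s, f i) = ∑ i ∈ s, scalarLaurent (f i) := by
  classical
  induction s using Finset.induction_on with
  | empty => simp [scalarLaurent_zero]
  | insert i s hi ih =>
    have h := fun j hj => hf j (Finset.mem_insert_of_mem hj)
    rw [Finset.sum_insert hi, Finset.sum_insert hi, scalarLaurent_add (hf i (by simp))
      (memLp_finsetSum' s h), ih h]

theorem entry_apply (i : Fin N) (x : L2Z N) (k : ℤ) : entry i x k = x k i := by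
  rw [entry, lp.mapCLM_apply_coe]
  simp

theorem embed_apply (i j : Fin N) (x : lp (fun _ : ℤ => ℂ) 2) (k : ℤ) :
    embed i x k j = if j = i then x k else 0 := by
  rw [embed, lp.mapCLM_apply_coe, unitVec]
  simp

theorem entry_embed (i j : Fin N) (x : lp (fun _ : ℤ => ℂ) 2) :
    entry i (embed j x) = if i = j then x else 0 := by
  ext k
  rw [entry_apply, embed_apply]
  split_ifs <;> simp

theorem ext_entry {x y : L2Z N} (h : ∀ i, entry i x = entry i y) : x = y := by
  ext k i
  rw [← entry_apply, ← entry_apply, h]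

theorem entry_laurent (a : MatFun N) (i : Fin N) (x : L2Z N) :
    entry i (laurent a x) = ∑ j, scalarLaurent (fun t => a t i j) (entry j x) := by
  simp only [laurent, _root_.sum_apply, ContinuousLinearMap.comp_apply, map_sum, entry_embed]
  rw [Finset.sum_eq_single i (by intro b _ hb; simp [hb.symm]) (by simp)]
  simp

theorem laurent_congr {a b : MatFun N} (ha : a ∈ LInf N) (h : a =ᵐ[haarT] b) :
    laurent a = laurent b := by
  unfold laurent
  refine Finset.sum_congr rfl fun i _ => Finset.sum_congr rfl fun j _ => ?_
  rw [scalarLaurent_congr (ha i j) (g := fun t => b t i j) (h.mono fun t ht => by simp only [ht])]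

theorem entry_mul_eq (a b : MatFun N) (i j : Fin N) :
    (fun t => (a t * b t) i j) = ∑ k, (fun t => a t i k) * fun t => b t k j := by
  ext t
  simp [Matrix.mul_apply]

theorem LInf_mul {a b : MatFun N} (ha : a ∈ LInf N) (hb : b ∈ LInf N) :
    (fun t => a t * b t) ∈ LInf N := fun i j => by
  rw [entry_mul_eq]
  exact memLp_finsetSum' _ fun k _ => (hb k j).mul (ha i k)

theorem laurent_mul {a b : MatFun N} (ha : a ∈ LInf N) (hb : b ∈ LInf N) :
    laurent (fun t => a t * b t) = laurent a * laurent b := by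
  have h1 : ∀ i j, scalarLaurent (fun t => (a t * b t) i j) =
      ∑ k, scalarLaurent (fun t => a t i k) ∘L scalarLaurent (fun t => b t k j) := fun i j => by
    rw [entry_mul_eq, scalarLaurent_sum _ fun k _ => (hb k j).mul (ha i k)]
    exact Finset.sum_congr rfl fun k _ => scalarLaurent_mul (ha i k) (hb k j)
  ext1 x
  refine ext_entry fun i => ?_
  change _ = entry i (laurent a (laurent b x))
  simp only [entry_laurent, h1, _root_.sum_apply, ContinuousLinearMap.comp_apply, map_sum]
  exact Finset.sum_comm

theorem laurent_one : laurent (fun _ => (1 : Matrix (Fin N) (Fin N) ℂ)) = 1 := by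
  ext1 x
  refine ext_entry fun i => ?_
  rw [entry_laurent, Finset.sum_eq_single i]
  · rw [show (fun _ : UCircle => (1 : Matrix (Fin N) (Fin N) ℂ) i i) = 1 by ext; simp,
      scalarLaurent_one]
    rfl
  · intro j _ hj
    rw [show (fun _ : UCircle => (1 : Matrix (Fin N) (Fin N) ℂ) i j) = 0 by ext; simp [hj.symm],
      scalarLaurent_zero]
    simp
  · simp

theorem laurent_mul_eq_one {a b : MatFun N} (ha : a ∈ LInf N) (hb : b ∈ LInf N)
    (h : ∀ᵐ t ∂haarT, a t * b t = 1) : laurent a * laurent b = 1 := by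
  rw [← laurent_mul ha hb, ← laurent_one]
  exact laurent_congr (LInf_mul ha hb) h

theorem InvertibleIn.laurent_mul_pinv {E : Set (MatFun N)} (hE : E ⊆ LInf N) {u : MatFun N}
    (h : InvertibleIn E u) :
    laurent u * laurent (pinv u) = 1 ∧ laurent (pinv u) * laurent u = 1 := by
  refine ⟨laurent_mul_eq_one (hE h.1) (hE h.2.2) ?_, laurent_mul_eq_one (hE h.2.2) (hE h.1) ?_⟩
  · filter_upwards [h.2.1] with t ht
    exact Matrix.mul_nonsing_inv _ ((Matrix.isUnit_iff_isUnit_det _).1 ht)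
  · filter_upwards [h.2.1] with t ht
    exact Matrix.nonsing_inv_mul _ ((Matrix.isUnit_iff_isUnit_det _).1 ht)

theorem laurent_eq_mul {a u v : MatFun N} (hu : u ∈ LInf N) (hv : v ∈ LInf N)
    (h : ∀ᵐ t ∂haarT, a t = u t * v t) : laurent a = laurent u * laurent v := by
  rw [← laurent_mul hu hv]
  exact (laurent_congr (LInf_mul hu hv) (h.mono fun t ht => ht.symm)).symm

theorem laurent_pinv_eq_mul {a u v : MatFun N} (hu : pinv u ∈ LInf N) (hv : pinv v ∈ LInf N)
    (h : ∀ᵐ t ∂haarT, a t = u t * v t) :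
    laurent (pinv a) = laurent (pinv v) * laurent (pinv u) :=
  laurent_eq_mul hv hu (h.mono fun t ht => by simp only [pinv, ht, Matrix.mul_inv_rev])

theorem single_eq_sum (k : ℤ) (v : EuclideanSpace ℂ (Fin N)) :
    (lp.single 2 k v : L2Z N) =
      ∑ β, v β • (lp.single 2 k (EuclideanSpace.single β (1 : ℂ)) : L2Z N) := by
  have h : v = ∑ β, v β • EuclideanSpace.single β (1 : ℂ) := by
    ext i
    simp [Pi.single_apply]
  conv_lhs => rw [h]
  change lp.singleContinuousLinearMap ℂ (fun _ : ℤ => EuclideanSpace ℂ (Fin N)) 2 k _ = _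
  rw [map_sum]
  exact Finset.sum_congr rfl fun β _ => map_smul _ _ _

/-- Bounded operators on `ℓ²(ℤ, ℂ^N)` with the same matrix are equal. -/
theorem ext_single {A B : L2Z N →L[ℂ] L2Z N}
    (h : ∀ (k : ℤ) (β : Fin N) (j : ℤ) (α : Fin N),
      A (lp.single 2 k (EuclideanSpace.single β (1 : ℂ))) j α =
        B (lp.single 2 k (EuclideanSpace.single β (1 : ℂ))) j α) : A = B := by
  refine lp.ext_continuousLinearMap (by simp) fun k => ?_
  ext1 v
  simp only [ContinuousLinearMap.comp_apply, lp.singleContinuousLinearMap_apply]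
  rw [single_eq_sum, map_sum, map_sum]
  refine Finset.sum_congr rfl fun β _ => ?_
  rw [map_smul, map_smul]
  congr 1
  ext j α
  exact h k β j α

end Laurent

/-! ### Coordinate projections and blocks of Laurent operators -/

section CoordProj

open Classical in
theorem coordProj_single (S : Set ℤ) (k : ℤ) (v : EuclideanSpace ℂ (Fin N)) :
    coordProj N S (lp.single 2 k v) = if k ∈ S then lp.single 2 k v else 0 := by
  ext1
  funext j
  rw [coordProj_apply]
  by_cases hj : j = k
  · subst hj
    split_ifs <;> simp
  · split_ifs <;> simp [lp.single_apply, hj]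

theorem coordProj_mul (S T : Set ℤ) :
    coordProj N S * coordProj N T = coordProj N (S ∩ T) := by
  ext x k : 3
  change coordProj N S (coordProj N T x) k = _
  simp only [coordProj_apply, Set.mem_inter_iff]
  split_ifs <;> simp_all

theorem one_sub_coordProj (S : Set ℤ) : 1 - coordProj N S = coordProj N Sᶜ := by
  ext x k : 3
  change x k - coordProj N S x k = _
  simp only [coordProj_apply, Set.mem_compl_iff]
  split_ifs <;> simp_all

theorem coordProj_sub {S T : Set ℤ} (h : T ⊆ S) :
    coordProj N S - coordProj N T = coordProj N (S \ T) := by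
  ext x k : 3
  change coordProj N S x k - coordProj N T x k = _
  simp only [coordProj_apply, Set.mem_sdiff]
  have := @h k
  split_ifs <;> simp_all

open Classical in
theorem coordProj_laurent_coordProj_single {b : MatFun N} (hb : b ∈ LInf N) (S T : Set ℤ)
    (k : ℤ) (β : Fin N) (j : ℤ) (α : Fin N) :
    (coordProj N S * laurent b * coordProj N T)
      (lp.single 2 k (EuclideanSpace.single β (1 : ℂ))) j α =
        if j ∈ S ∧ k ∈ T then coeff b (j - k) α β else 0 := by
  change coordProj N S (laurent b (coordProj N T _)) j α = _
  rw [coordProj_single, coordProj_apply, ← laurent_single hb]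
  split_ifs <;> simp_all

theorem coordProj_laurent_coordProj_eq_zero {b : MatFun N} (hb : b ∈ LInf N) {S T : Set ℤ}
    (h : ∀ j ∈ S, ∀ k ∈ T, coeff b (j - k) = 0) :
    coordProj N S * laurent b * coordProj N T = 0 := by
  classical
  refine ext_single fun k β j α => ?_
  rw [coordProj_laurent_coordProj_single hb]
  split_ifs with hjk
  · simp [h j hjk.1 k hjk.2]
  · simp

end CoordProj

/-! ### Hankel blocks of symbols in `K11` are trace class -/

section Hankel

/-- The standard basis vector of `ℓ²(ℤ, ℂ^N)` with index `(k, β)`. -/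
def stdVec (p : ℤ × Fin N) : L2Z N := lp.single 2 p.1 (EuclideanSpace.single p.2 (1 : ℂ))

theorem norm_stdVec (p : ℤ × Fin N) : ‖stdVec p‖ = 1 := by
  rw [stdVec, lp.norm_single (by simp)]
  simp

theorem stdVec_apply (p q : ℤ × Fin N) : stdVec p q.1 q.2 = if q = p then 1 else 0 := by
  rw [stdVec, lp.single_apply]
  obtain ⟨k, β⟩ := p
  obtain ⟨j, α⟩ := q
  by_cases h : j = k
  · subst h
    by_cases h' : α = β <;> simp [h']
  · simp [h]

theorem inner_stdVec (p q : ℤ × Fin N) :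
    inner ℂ (stdVec p) (stdVec q) = if p = q then (1 : ℂ) else 0 := by
  rw [stdVec, lp.inner_single_left, ← stdVec_apply]
  simp [EuclideanSpace.inner_single_left]

/-- A nuclear representation can be checked on the standard basis. -/
theorem isNuclearRep_of_stdVec {ι : Type*} {K : L2Z N →L[ℂ] L2Z N} {x y : ι → L2Z N}
    (h : Summable fun i => ‖x i‖ * ‖y i‖)
    (hK : ∀ p q : ℤ × Fin N,
      HasSum (fun i => inner ℂ (x i) (stdVec p) * y i q.1 q.2) (K (stdVec p) q.1 q.2)) :
    IsNuclearRep K x y := by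
  -- The rank one terms converge in operator norm, so their sum is bounded and is determined by its
  -- matrix.
  have h1 : Summable fun i => InnerProductSpace.rankOne ℂ (y i) (x i) :=
    Summable.of_norm (by simpa [mul_comm] using h)
  have h2 : ∀ v, HasSum (fun i => inner ℂ (x i) v • y i)
      ((∑' i, InnerProductSpace.rankOne ℂ (y i) (x i)) v) := fun v => by
    simpa using h1.hasSum.mapL (ContinuousLinearMap.apply ℂ (L2Z N) v)
  have h3 : K = ∑' i, InnerProductSpace.rankOne ℂ (y i) (x i) := by
    refine ext_single fun k β j α => ?_
    have h4 := ((h2 (stdVec (k, β))).mapL (entry α)).mapL (lp.evalCLM ℂ (fun _ : ℤ => ℂ) 2 j)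
    refine (hK (k, β) (j, α)).unique ?_
    have h5 : ∀ (z : lp (fun _ : ℤ => ℂ) 2), lp.evalCLM ℂ (fun _ : ℤ => ℂ) 2 j z = z j :=
      fun _ => rfl
    simp only [h5, entry_apply, map_smul, lp.coeFn_smul, Pi.smul_apply, smul_eq_mul] at h4
    exact h4
  exact ⟨h, fun v => h3 ▸ h2 v⟩

/-- The entries of a Hankel block are summable. -/
theorem summable_coeff_sub {b : MatFun N} (hb : b ∈ K11 N) {S T : Set ℤ} {F : ℤ → Finset ℤ}
    (hF : ∀ m k : ℤ, k ∈ T → m + k ∈ S → k ∈ F m) (hcard : ∀ m, ((F m).card : ℝ) ≤ |(m : ℝ)|) :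
    Summable fun i : (ℤ × ℤ) × (Fin N × Fin N) =>
      open Classical in
      ‖if i.1.1 ∈ S ∧ i.1.2 ∈ T then coeff b (i.1.1 - i.1.2) i.2.1 i.2.2 else 0‖ := by
  classical
  -- In the coordinates `(j - k, k)` the diagonal `m = j - k` meets the block only for `k ∈ F m`, so
  -- `coeff b m` is counted at most `|m|` times.
  let e : (ℤ × ℤ) ≃ (ℤ × ℤ) :=
    { toFun := fun p => (p.1 - p.2, p.2)
      invFun := fun p => (p.1 + p.2, p.2)
      left_inv := fun p => by simp
      right_inv := fun p => by simp }
  let c : ℤ → ℝ := fun m => ∑ i, ∑ j, ‖coeff b m i j‖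
  have hc : ∀ m, 0 ≤ c m := fun m => by positivity
  let g : ℤ × ℤ → ℝ := fun p => if p.2 ∈ F p.1 then c p.1 else 0
  have hg0 : 0 ≤ g := fun p => by
    dsimp only [g]
    split_ifs
    · exact hc _
    · exact le_rfl
  have hgsum : ∀ m, HasSum (fun k => g (m, k)) ((F m).card * c m) := fun m => by
    have := hasSum_sum_of_ne_finset_zero (s := F m) (f := fun k => g (m, k))
      (L := SummationFilter.unconditional ℤ) fun k hk => if_neg hk
    convert this using 1
    rw [Finset.sum_congr rfl (g := fun _ => c m) fun k hk => if_pos hk, Finset.sum_const,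
      nsmul_eq_mul]
  have hg : Summable g := by
    rw [summable_prod_of_nonneg hg0]
    refine ⟨fun m => (hgsum m).summable, ?_⟩
    refine Summable.of_nonneg_of_le (fun m => tsum_nonneg fun k => hg0 _) (fun m => ?_) hb.2
    rw [(hgsum m).tsum_eq]
    have := hcard m
    exact mul_le_mul_of_nonneg_right (by linarith) (hc m)
  have hge : Summable fun p => g (e p) := (e.summable_iff (f := g)).2 hg
  have hle : ∀ p : (ℤ × ℤ) × (Fin N × Fin N),
      ‖if p.1.1 ∈ S ∧ p.1.2 ∈ T then coeff b (p.1.1 - p.1.2) p.2.1 p.2.2 else 0‖ ≤ g (e p.1) := by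
    rintro ⟨⟨j, k⟩, α, β⟩
    dsimp only
    split_ifs with h
    · have h1 : g (e (j, k)) = c (j - k) := if_pos (hF _ _ h.2 (by simpa [e] using h.1))
      rw [h1]
      exact (Finset.single_le_sum (f := fun j' => ‖coeff b (j - k) α j'‖)
        (fun _ _ => norm_nonneg _) (Finset.mem_univ β)).trans
        (Finset.single_le_sum (f := fun i' => ∑ j', ‖coeff b (j - k) i' j'‖)
          (fun _ _ => by positivity) (Finset.mem_univ α))
    · simpa using hg0 _
  refine Summable.of_nonneg_of_le (fun _ => norm_nonneg _) hle ?_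
  have := hge.mul_of_nonneg (g := fun _ : Fin N × Fin N => (1 : ℝ)) (Summable.of_finite)
    (fun p => hg0 (e p)) fun _ => zero_le_one
  simpa using this

/-- Expanding the block in matrix units gives rank one terms whose norms are the absolute values of
the entries. -/
theorem isTraceClass_coordProj_laurent_coordProj {b : MatFun N} (hb : b ∈ K11 N) {S T : Set ℤ}
    {F : ℤ → Finset ℤ} (hF : ∀ m k : ℤ, k ∈ T → m + k ∈ S → k ∈ F m)
    (hcard : ∀ m, ((F m).card : ℝ) ≤ |(m : ℝ)|) :
    IsTraceClass (coordProj N S * laurent b * coordProj N T) := by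
  classical
  let a : (ℤ × ℤ) × (Fin N × Fin N) → ℂ := fun i =>
    if i.1.1 ∈ S ∧ i.1.2 ∈ T then coeff b (i.1.1 - i.1.2) i.2.1 i.2.2 else 0
  refine (isNuclearRep_of_stdVec (x := fun i : (ℤ × ℤ) × (Fin N × Fin N) => stdVec (i.1.2, i.2.2))
    (y := fun i => a i • stdVec (i.1.1, i.2.1)) ?_ ?_).isTraceClass
  · simpa only [norm_smul, norm_stdVec, one_mul, mul_one] using summable_coeff_sub hb hF hcard
  · rintro ⟨k, β⟩ ⟨j, α⟩
    have h1 := coordProj_laurent_coordProj_single hb.1 S T k β j α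
    change (coordProj N S * laurent b * coordProj N T) (stdVec (k, β)) j α = _ at h1
    rw [h1]
    convert hasSum_ite_eq ((j, k), (α, β)) (a ((j, k), (α, β))) using 1
    · ext ⟨⟨j', k'⟩, α', β'⟩
      have h2 := stdVec_apply (j', α') (j, α)
      dsimp only at h2
      rw [inner_stdVec, lp.coeFn_smul, Pi.smul_apply, PiLp.smul_apply, h2]
      rw [smul_eq_mul]
      by_cases h3 : (k', β') = (k, β)
      · by_cases h4 : (j, α) = (j', α')
        · obtain ⟨rfl, rfl⟩ := Prod.mk.inj h3
          obtain ⟨rfl, rfl⟩ := Prod.mk.inj h4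
          simp
        · rw [if_neg h4, mul_zero, mul_zero, if_neg]
          intro h5
          simp only [Prod.mk.injEq] at h4 h5
          exact h4 ⟨h5.1.1.symm, h5.2.1.symm⟩
      · rw [if_neg h3, zero_mul, if_neg]
        intro h5
        simp only [Prod.mk.injEq] at h3 h5
        exact h3 ⟨h5.1.2, h5.2.2⟩

/-- On the diagonal `m`, a pair `(m + k, k)` straddles the cut at `n` only if `k` is within distance
`|m|` of it. -/
theorem isTraceClass_hankel {b : MatFun N} (hb : b ∈ K11 N) (n : ℤ) :
    IsTraceClass (projQn N n * laurent b * (1 - projQn N n)) ∧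
      IsTraceClass ((1 - projQn N n) * laurent b * projQn N n) := by
  rw [projQn, one_sub_coordProj]
  constructor
  · refine isTraceClass_coordProj_laurent_coordProj hb (F := fun m => Finset.Ico (n - m) n) ?_ ?_
    · intro m k h1 h2
      simp only [Set.mem_compl_iff, Set.mem_ofPred_eq, Finset.mem_Ico] at *
      omega
    · intro m
      rw [Int.card_Ico]
      have : ((n - (n - m)).toNat : ℤ) ≤ |m| := by
        rw [sub_sub_cancel, Int.ofNat_toNat]
        exact max_le (le_abs_self m) (abs_nonneg m)
      exact_mod_cast this
  · refine isTraceClass_coordProj_laurent_coordProj hb (F := fun m => Finset.Ico n (n - m)) ?_ ?_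
    · intro m k h1 h2
      simp only [Set.mem_compl_iff, Set.mem_ofPred_eq, Finset.mem_Ico] at *
      omega
    · intro m
      rw [Int.card_Ico]
      have : ((n - m - n).toNat : ℤ) ≤ |m| := by
        rw [sub_right_comm, sub_self, zero_sub, Int.ofNat_toNat]
        exact max_le (neg_le_abs m) (abs_nonneg m)
      exact_mod_cast this

end Hankel

/-! ### Determinants of finite-rank coordinate perturbations -/

section FiniteRank

theorem gramDet_of_fintype {ι H : Type*} [Fintype ι] [DecidableEq ι] [NormedAddCommGroup H]
    [InnerProductSpace ℂ H] (x y : ι → H) :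
    gramDet x y = (1 + Matrix.of fun i j => inner ℂ (x i) (y j)).det := by
  classical
  rw [det_one_add_eq_sum_minors, gramDet, tsum_fintype]
  refine Finset.sum_congr rfl fun T _ => ?_
  unfold gramMinor
  congr!

/-- In the standard vectors the Gram matrix is `c` times the identity of size `S.card * N`. -/
theorem hasFredholmDet_one_add_smul_coordProj (S : Finset ℤ) (c : ℂ) :
    HasFredholmDet (1 + c • coordProj N S) ((1 + c) ^ (S.card * N)) := by
  classical
  have h : IsNuclearRep (c • coordProj N S) (fun i : S × Fin N => stdVec ((i.1 : ℤ), i.2))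
      fun i => c • stdVec ((i.1 : ℤ), i.2) := by
    refine isNuclearRep_of_stdVec Summable.of_finite ?_
    rintro ⟨k, β⟩ ⟨j, α⟩
    have h1 : (c • coordProj N S) (stdVec (k, β)) j α =
        ∑ i : S × Fin N, inner ℂ (stdVec ((i.1 : ℤ), i.2)) (stdVec (k, β)) *
          (c • stdVec ((i.1 : ℤ), i.2) : L2Z N) j α := by
      change c * (coordProj N S (stdVec (k, β)) j α) = _
      have h2 : ∀ q : ℤ × Fin N, (c • stdVec q : L2Z N) j α = c * (if (j, α) = q then 1 else 0) :=
        fun q => by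
          rw [lp.coeFn_smul, Pi.smul_apply, PiLp.smul_apply, smul_eq_mul, ← stdVec_apply]
      simp only [h2, inner_stdVec]
      rw [stdVec, coordProj_single]
      by_cases hk : k ∈ S
      · rw [Finset.sum_eq_single (⟨k, hk⟩, β)]
        · have h3 := stdVec_apply (k, β) (j, α)
          have h4 : (k, β).1 ∈ (S : Set ℤ) := hk
          rw [if_pos h4]
          change c * (stdVec (k, β) j α) = _
          rw [h3, if_pos rfl, one_mul]
        · rintro ⟨⟨k', hk'⟩, β'⟩ - hne
          rw [if_neg, zero_mul]
          simpa [Prod.ext_iff] using hne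
        · simp
      · rw [if_neg (by simpa using hk), Finset.sum_eq_zero]
        · simp
        · rintro ⟨⟨k', hk'⟩, β'⟩ -
          rw [if_neg, zero_mul]
          rintro h3
          obtain ⟨rfl, -⟩ := Prod.mk.inj h3
          exact hk hk'
    rw [h1]
    exact hasSum_fintype _
  have h2 := h.hasFredholmDet
  rw [gramDet_of_fintype] at h2
  convert h2
  have h3 : (1 + Matrix.of fun i j : S × Fin N => inner ℂ (stdVec ((i.1 : ℤ), i.2))
      (c • stdVec ((j.1 : ℤ), j.2) : L2Z N)) = (1 + c) • (1 : Matrix (S × Fin N) (S × Fin N) ℂ) := by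
    ext i j
    rw [Matrix.add_apply, Matrix.of_apply, inner_smul_right, inner_stdVec, Matrix.smul_apply,
      Matrix.one_apply]
    simp only [Prod.mk.injEq, Subtype.coe_inj, ← Prod.ext_iff]
    split_ifs <;> simp
  rw [h3, Matrix.det_smul, Matrix.det_one, mul_one]
  simp

end FiniteRank

/-! ### Specialization to `P`, `Q_n` and Hardy space symbols -/

section Main

/-- The sign of `n` decides which projection is smaller; the difference keeps the `|n|` indices
between `0` and `n`. In each case the exponent is nonnegative, so `c = -1` is covered as well. -/
theorem coordProj_le_cases (n : ℤ) :
    (projP N * projQn N n = projQn N n ∧ projQn N n * projP N = projQn N n ∧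
      ∀ c : ℂ, HasFredholmDet (1 + c • (projP N - projQn N n)) ((1 + c) ^ (n * (N : ℤ)))) ∨
    (projP N * projQn N n = projP N ∧ projQn N n * projP N = projP N ∧
      ∀ c : ℂ, HasFredholmDet (1 + c • (projQn N n - projP N)) ((1 + c) ^ (-(n * (N : ℤ))))) := by
  simp only [projP, projQn, coordProj_mul]
  rcases le_total 0 n with hn | hn
  · have h : {k : ℤ | n ≤ k} ⊆ {k : ℤ | 0 ≤ k} := fun k (hk : n ≤ k) => hn.trans hk
    refine Or.inl ⟨by rw [Set.inter_eq_right.2 h], by rw [Set.inter_eq_left.2 h], fun c => ?_⟩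
    rw [coordProj_sub h]
    convert hasFredholmDet_one_add_smul_coordProj (N := N) (Finset.Ico 0 n) c using 4
    · ext k; simp
    · rw [← zpow_natCast]; simp [hn]
  · have h : {k : ℤ | 0 ≤ k} ⊆ {k : ℤ | n ≤ k} := fun k (hk : 0 ≤ k) => hn.trans hk
    refine Or.inr ⟨by rw [Set.inter_eq_left.2 h], by rw [Set.inter_eq_right.2 h], fun c => ?_⟩
    rw [coordProj_sub h]
    convert hasFredholmDet_one_add_smul_coordProj (N := N) (Finset.Ico n 0) c using 4
    · ext k; simp
    · rw [← zpow_natCast]; simp [hn]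

theorem projQ_eq : projQ N = 1 - projP N := by
  rw [projQ, projP, one_sub_coordProj]
  congr 1
  ext k
  simp

theorem projQn_mul_self (n : ℤ) : projQn N n * projQn N n = projQn N n := by
  rw [projQn, coordProj_mul, Set.inter_self]

/-- Multiplication by a function in `H^∞_-` preserves the sequences supported in `(-∞, n)`. -/
theorem projQn_laurent_of_hardyMinus {b : MatFun N} (hb : b ∈ HardyMinus N) (n : ℤ) :
    projQn N n * laurent b * (1 - projQn N n) = 0 := by
  rw [projQn, one_sub_coordProj]
  refine coordProj_laurent_coordProj_eq_zero hb.1 fun j hj k hk => hb.2 _ ?_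
  simp only [Set.mem_compl_iff, Set.mem_ofPred_eq] at hj hk
  omega

/-- Multiplication by a function in `H^∞_+` preserves the sequences supported in `[n, ∞)`. -/
theorem projQn_laurent_of_hardyPlus {b : MatFun N} (hb : b ∈ HardyPlus N) (n : ℤ) :
    (1 - projQn N n) * laurent b * projQn N n = 0 := by
  rw [projQn, one_sub_coordProj]
  refine coordProj_laurent_coordProj_eq_zero hb.1 fun j hj k hk => ?_
  simp only [Set.mem_compl_iff, Set.mem_ofPred_eq] at hj hk
  rw [show j - k = -(k - j) by ring]
  exact hb.2 _ (by omega)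

theorem one_sub_mul_one_sub {A : Type*} [Ring A] (p q : A) :
    (1 - p) * (1 - q) = 1 - p - q + p * q := by
  noncomm_ring

end Main

end BlockToeplitz

end

theorem theorem1p3 (N : ℕ) (a : MatFun N) (hr : a ∈ PhiR (K11 N)) (hl : a ∈ PhiL (K11 N))
    (n : ℤ) (s : ℂ) :
    ∃ d d₁ d₂ : ℂ,
      HasFredholmDet (1 + s • projP N - s • (laurent a * projQn N n * laurent (pinv a))) d ∧
      HasFredholmDet
        (1 - s ^ 2 • (projQn N n * laurent (pinv a) * projQ N * laurent a * projQn N n)) d₁ ∧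
      HasFredholmDet
        (1 - s ^ 2 •
          ((1 - projQn N n) * laurent (pinv a) * projP N * laurent a * (1 - projQn N n))) d₂ ∧
      (s ≠ -1 → d = (1 + s) ^ (n * (N : ℤ)) * d₁) ∧
      (s ≠ 1 → d = (1 - s) ^ (-(n * (N : ℤ))) * d₂) := by
  have hMinus : K11 N ∩ HardyMinus N ⊆ LInf N := fun _ h => h.1.1
  have hPlus : K11 N ∩ HardyPlus N ⊆ LInf N := fun _ h => h.1.1
  -- `projP N` is `projQn N 0` by definition, so the facts on `projQn` apply to it with cut `0`.
  have hP : projP N * projP N = projP N := projQn_mul_self 0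
  have hR : projQn N n * projQn N n = projQn N n := projQn_mul_self n
  obtain ⟨-, u, u', hu, hum, hup⟩ := hr
  obtain ⟨-, v', v, hv, hvp, hvm⟩ := hl
  obtain ⟨d, d₁, hd, hd₁, h₁⟩ := exists_hasFredholmDet_of_factorization hP hR
    (hum.laurent_mul_pinv hMinus).1 (hum.laurent_mul_pinv hMinus).2
    (hup.laurent_mul_pinv hPlus).1 (hup.laurent_mul_pinv hPlus).2
    (projQn_laurent_of_hardyMinus hum.1.2 0) (projQn_laurent_of_hardyMinus hum.2.2.2 0)
    (projQn_laurent_of_hardyPlus hup.1.2 n) (projQn_laurent_of_hardyPlus hup.2.2.2 n)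
    (isTraceClass_hankel hum.2.2.1 0).2 (isTraceClass_hankel hup.2.2.1 n).1 s _
    (coordProj_le_cases n)
  -- Complements reverse the order of the projections, so the two cases swap and the exponent
  -- changes sign.
  have hcases : ((1 - projP N) * (1 - projQn N n) = 1 - projQn N n ∧
      (1 - projQn N n) * (1 - projP N) = 1 - projQn N n ∧
      ∀ c : ℂ, HasFredholmDet (1 + c • ((1 - projP N) - (1 - projQn N n)))
        ((1 + c) ^ (-(n * (N : ℤ))))) ∨
      ((1 - projP N) * (1 - projQn N n) = 1 - projP N ∧
      (1 - projQn N n) * (1 - projP N) = 1 - projP N ∧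
      ∀ c : ℂ, HasFredholmDet (1 + c • ((1 - projQn N n) - (1 - projP N)))
        ((1 + c) ^ (- -(n * (N : ℤ))))) := by
    simp only [sub_sub_sub_cancel_left, neg_neg]
    rcases coordProj_le_cases (N := N) n with ⟨h1, h2, h3⟩ | ⟨h1, h2, h3⟩
    · refine Or.inr ⟨?_, ?_, h3⟩ <;> rw [one_sub_mul_one_sub]
      · rw [h1]; abel
      · rw [h2]; abel
    · refine Or.inl ⟨?_, ?_, h3⟩ <;> rw [one_sub_mul_one_sub]
      · rw [h1]; abel
      · rw [h2]; abel
  have hP' := (IsIdempotentElem.one_sub (a := projP N) hP).eq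
  have hR' := (IsIdempotentElem.one_sub (a := projQn N n) hR).eq
  -- Multiplication by `v_+` preserves the range of `P`, that is, the kernel of `1 - P`;
  -- multiplication by `v_-` preserves the range of `1 - Q_n`.
  obtain ⟨d', d₂, hd', hd₂, h₂⟩ := exists_hasFredholmDet_of_factorization hP' hR'
    (hvp.laurent_mul_pinv hPlus).1 (hvp.laurent_mul_pinv hPlus).2
    (hvm.laurent_mul_pinv hMinus).1 (hvm.laurent_mul_pinv hMinus).2
    (by rw [sub_sub_cancel]; exact projQn_laurent_of_hardyPlus hvp.1.2 0)
    (by rw [sub_sub_cancel]; exact projQn_laurent_of_hardyPlus hvp.2.2.2 0)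
    (by rw [sub_sub_cancel]; exact projQn_laurent_of_hardyMinus hvm.1.2 n)
    (by rw [sub_sub_cancel]; exact projQn_laurent_of_hardyMinus hvm.2.2.2 n)
    (by rw [sub_sub_cancel]; exact (isTraceClass_hankel hvp.2.2.1 0).1)
    (by rw [sub_sub_cancel]; exact (isTraceClass_hankel hvm.2.2.1 n).2) (-s) _ hcases
  have hA₁ := laurent_eq_mul (hMinus hum.1) (hPlus hup.1) hu
  have hB₁ := laurent_pinv_eq_mul (hMinus hum.2.2) (hPlus hup.2.2) hu
  have hA₂ := laurent_eq_mul (hPlus hvp.1) (hMinus hvm.1) hv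
  have hB₂ := laurent_pinv_eq_mul (hPlus hvp.2.2) (hMinus hvm.2.2) hv
  rw [← hA₁, ← hB₁] at hd hd₁
  have hAB : laurent a * laurent (pinv a) = 1 := by
    rw [hA₁, hB₁, mul_assoc, ← mul_assoc (laurent u'), (hup.laurent_mul_pinv hPlus).1, one_mul,
      (hum.laurent_mul_pinv hMinus).1]
  rw [← hA₂, ← hB₂] at hd' hd₂
  -- The two terms `∓s` arising from the complements cancel because `L(a) L(a⁻¹) = 1`; uniqueness of
  -- the determinant then identifies `d` with `d'`.
  have hT : 1 + (-s) • (1 - projP N) - (-s) • (laurent a * (1 - projQn N n) * laurent (pinv a)) =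
      1 + s • projP N - s • (laurent a * projQn N n * laurent (pinv a)) := by
    rw [mul_sub, sub_mul, mul_one, hAB]
    module
  rw [hT] at hd'
  rw [sub_sub_cancel, neg_sq] at hd₂
  rw [projQ_eq]
  refine ⟨d, d₁, d₂, hd, hd₁, hd₂, h₁, fun hs => ?_⟩
  rw [hd.unique hd', h₂ fun h => hs (by linear_combination -h), ← sub_eq_add_neg]
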